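/- Let $S$ be a finite set and $\mu:S\times S\to\mathbb{R}_+$ a directed distance (i.e. $\mu(s,s)=0$ for all $s$). \emph{Notation.} Let $S^c,S^r$ be disjoint copies of $S$, $S^{cr}=S^c\cup S^r$, and write $s^c,s^r$ for the copies of $s\in S$. Let $P_\mu=\{p\in\mathbb{R}^{S^{cr}} \mid p(s^c)+p(t^r)\ge\mu(s,t)\ (s,t\in S)\}$ and let $Q_\mu$ be the set of minimal elements of $P_\mu$. For a set $R\subseteq \mathbb{R}^{S^{cr}}$, $R^+$ is the set of its nonnegative points, and $R_s$ is the set of $p\in R$ with $p(s^c)+p(s^r)=0$. Let $\mu_s$ be the point with $\mu_s(t^c)=\mu(t,s)$, $\mu_s(t^r)=\mu(s,t)$. For $p\in P_\mu$ let $K(p)$ be the bipartite graph on $S^{cr}$ with edges $s^ct^r$ for $p(s^c)+p(t^r)=\mu(s,t)$, and let $N_p(U)$ be the set of nodes outside $U$ joined to $U$ in $K(p)$. Let $\mathcal{S}_0$ be the family of $X\subseteq S$ with $\mu=0$ on $X\times X$; for $X\in\mathcal{S}_0$ let $Q_{\mu,X}$ be the set of $p\in Q_\mu$ such that $s^cs^r$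 is an edge of $K(p)$ exactly when $s\in X$. A point $p\in Q_{\mu,X}$ is a \emph{fat} (relative to $X$) if $N_p(S^c\setminus X^c)\subseteq S^r\setminus X^r$ or $N_p(S^r\setminus X^r)\subseteq S^c\setminus X^c$; $Q_{\mu,X}^{deg}$ is the set of $p\in Q_{\mu,X}$ for which one of these inclusions is an equality. A fat in no $Q_{\mu,X}^{deg}$ is \emph{proper}, and $Q_\mu^{slim}$ is $Q_\mu$ without the proper fats. On $Q_\mu^{slim}$ let $p\sim q$ if $p-q\in(\mathbf 1,-\mathbf 1)\mathbb{R}$, or if for some $X\in\mathcal{S}_0$ both $p,q\in Q_{\mu,X}^{deg}$ and $p-q\in(\mathbf 1,-\mathbf 1)\mathbb{R}+(\mathbf 1_{X^c},-\mathbf 1_{X^r})\mathbb{R}$. A \emph{slimmed section} in $(Q_\mu^{slim})^+$ is a subset $R$ of $(Q_\mu^{slim})^+$ that maps bijectively onto $Q_\mu^{slim}/\!\sim$, that is balanced (no $p,q\in R$ have $p(s^c)<q(s^c)$ for all $s\in S$, or $p(s^r)<q(s^r)$ for all $s\in S$), and such that for no $X\in\mathcal{S}_0$ are there distinct $p,q\in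 R\cap(Q_{\mu,X}^{deg})^+$ with $p(s^c)<q(s^c)$ for all $s\in S\setminus X$, or $p(s^r)<q(s^r)$ for all $s\in S\setminus X$. An \emph{oriented tree} $\Gamma$ is a directed graph whose underlying undirected graph is a tree; a subtree is a subgraph whose underlying graph is a tree. For edge lengths $\alpha:E\Gamma\to\mathbb{R}_+$, $D_{\Gamma,\alpha}(u,v)$ is the sum of $\alpha(e)$ over the edges $e$ traversed in their forward direction by the path of $\Gamma$ from $u$ to $v$, and $D_{\Gamma,\alpha}(A,B)$ is its minimum over pairs in $A\times B$. An \emph{oriented-tree realization} of $\mu$ is a triple $(\Gamma,\alpha;\{F_s\}_{s\in S})$ of an oriented tree, nonnegative edge lengths and subtrees $F_s$ with $\mu(s,t)=D_{\Gamma,\alpha}(F_s,F_t)$ for all $s,t\in S$. \textbf{Proposition.} Suppose that $\mu$ has an oriented-tree realization $(\Gamma,\alpha;\{F_s\}_{s\in S})$ such that $\{F_s\}_{s\in S}$ contains all single-node subtrees of $\Gamma$. Let $S_0\subseteq S$ be the set of $s$ such that $F_s$ is a single node $v_s$. Then: \begin{enumerate} \item[(1)] $(Q_\mu^{slim})^+=\{\mu_s\mid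 s\in S_0\}\cup\bigcup\{[\mu_s,\mu_t]\mid s,t\in S_0,\ v_sv_t\in E\Gamma\}$. \item[(2)] $(Q_\mu^{slim})^+_s=\{\mu_t\mid t\in S_0,\ v_t\in VF_s\}\cup\bigcup\{[\mu_t,\mu_u]\mid t,u\in S_0,\ v_tv_u\in EF_s\}$ for every $s\in S$. \item[(3)] $(Q_\mu^{slim})^+$ itself is a slimmed section. \item[(4)] If $\mu\ne 0$, then for every $s\in S$ such that $F_s$ is a single node or a directed path, $(Q_\mu)_s$ contains no fat. \end{enumerate} (The one-point sets in (1) and (2) are redundant as soon as $\Gamma$, respectively $F_s$, has an edge.) -/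

import Mathlib

noncomputable section

namespace DirectedMultiflow

/-! ### Directed distances and the polyhedra `P_μ`, `Q_μ` -/

/-- A directed distance on `S`: a nonnegative function on `S × S` with zero diagonal. -/
structure IsDirectedDistance {S : Type*} (μ : S → S → ℝ) : Prop where
  nonneg : ∀ s t, 0 ≤ μ s t
  diag : ∀ s, μ s s = 0

/-- The space `ℝ^{S^{cr}}`, where `S^{cr}` is the disjoint union of two copies of `S`: the
coordinate `s^c` is `Sum.inl s`, and `s^r` is `Sum.inr s`. -/
abbrev CRSpace (S : Type*) : Type _ := S ⊕ S → ℝ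

/-- `P_μ = {p | p(s^c) + p(t^r) ≥ μ(s,t) for all s, t}`. -/
def P {S : Type*} (μ : S → S → ℝ) : Set (CRSpace S) :=
  {p | ∀ s t, μ s t ≤ p (Sum.inl s) + p (Sum.inr t)}

/-- `Q_μ`, the set of minimal elements of `P_μ`. -/
def Q {S : Type*} (μ : S → S → ℝ) : Set (CRSpace S) :=
  {p | Minimal (fun q => q ∈ P μ) p}

/-- `R^+`, the set of nonnegative points of `R`. -/
def nonnegPart {S : Type*} (R : Set (CRSpace S)) : Set (CRSpace S) :=
  {p | p ∈ R ∧ ∀ u, 0 ≤ p u}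

/-- `R_s`, the set of points `p ∈ R` with `p(s^c) + p(s^r) = 0`. -/
def region {S : Type*} (R : Set (CRSpace S)) (s : S) : Set (CRSpace S) :=
  {p | p ∈ R ∧ p (Sum.inl s) + p (Sum.inr s) = 0}

/-- The point `μ_s`, with `μ_s(t^c) = μ(t,s)` and `μ_s(t^r) = μ(s,t)`. -/
def pt {S : Type*} (μ : S → S → ℝ) (s : S) : CRSpace S :=
  Sum.elim (fun t => μ t s) (fun t => μ s t)

/-- The bipartite graph `K(p)` on `S^{cr}` with edge set
`{s^c t^r | p(s^c) + p(t^r) = μ(s,t)}`. -/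
def K {S : Type*} (μ : S → S → ℝ) (p : CRSpace S) : SimpleGraph (S ⊕ S) where
  Adj a b :=
    (∃ s t, a = Sum.inl s ∧ b = Sum.inr t ∧ p (Sum.inl s) + p (Sum.inr t) = μ s t) ∨
    (∃ s t, b = Sum.inl s ∧ a = Sum.inr t ∧ p (Sum.inl s) + p (Sum.inr t) = μ s t)
  symm := ⟨fun _ _ h => h.symm⟩
  loopless := ⟨by
    rintro a (⟨s, t, h₁, h₂, -⟩ | ⟨s, t, h₁, h₂, -⟩) <;>
    exact Sum.inl_ne_inr (h₁.symm.trans h₂)⟩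

/-- `N_p(U)`: the nodes of `K(p)` outside `U` that are joined to some node of `U`. -/
def N {S : Type*} (μ : S → S → ℝ) (p : CRSpace S) (U : Set (S ⊕ S)) : Set (S ⊕ S) :=
  {v | v ∉ U ∧ ∃ u ∈ U, (K μ p).Adj u v}

/-! ### Fats, degenerate sets, the slimmed tropical polytope -/

/-- `𝒮₀`, the family of subsets of `S` on which `μ` vanishes. -/
def S0 {S : Type*} (μ : S → S → ℝ) : Set (Set S) :=
  {X | ∀ s ∈ X, ∀ t ∈ X, μ s t = 0}

/-- `Q_{μ,X}`: the points `p ∈ Q_μ` such that `s^c s^r` is an edge of `K(p)` iff `s ∈ X`. -/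
def QX {S : Type*} (μ : S → S → ℝ) (X : Set S) : Set (CRSpace S) :=
  {p | p ∈ Q μ ∧ ∀ s, (K μ p).Adj (Sum.inl s) (Sum.inr s) ↔ s ∈ X}

/-- `p` is a fat relative to `X`. -/
def IsFatRel {S : Type*} (μ : S → S → ℝ) (X : Set S) (p : CRSpace S) : Prop :=
  X ∈ S0 μ ∧ p ∈ QX μ X ∧
    (N μ p (Sum.inl '' Xᶜ) ⊆ Sum.inr '' Xᶜ ∨ N μ p (Sum.inr '' Xᶜ) ⊆ Sum.inl '' Xᶜ)

/-- `p` is a fat (relative to some `X`). -/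
def IsFat {S : Type*} (μ : S → S → ℝ) (p : CRSpace S) : Prop :=
  ∃ X, IsFatRel μ X p

/-- The degenerate set `Q_{μ,X}^{deg}` relative to `X`. -/
def Qdeg {S : Type*} (μ : S → S → ℝ) (X : Set S) : Set (CRSpace S) :=
  {p | p ∈ QX μ X ∧
    (N μ p (Sum.inl '' Xᶜ) = Sum.inr '' Xᶜ ∨ N μ p (Sum.inr '' Xᶜ) = Sum.inl '' Xᶜ)}

/-- A proper fat: a fat that belongs to no degenerate set. -/
def IsProperFat {S : Type*} (μ : S → S → ℝ) (p : CRSpace S) : Prop :=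
  IsFat μ p ∧ ∀ X ∈ S0 μ, p ∉ Qdeg μ X

/-- `Q_μ^{slim}`: `Q_μ` with all proper fats deleted. -/
def Qslim {S : Type*} (μ : S → S → ℝ) : Set (CRSpace S) :=
  {p | p ∈ Q μ ∧ ¬ IsProperFat μ p}

/-- The vector `(𝟏_{X^c}, -𝟏_{X^r})`; for `X = S` it is `(𝟏, -𝟏)`. -/
def shiftVec {S : Type*} (X : Set S) : CRSpace S :=
  Sum.elim (X.indicator fun _ => 1) (fun s => - X.indicator (fun _ => (1 : ℝ)) s)

/-- The relation `∼`: `p - q ∈ (𝟏,-𝟏)ℝ`, or for some `X ∈ 𝒮₀` both points lie in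
`Q_{μ,X}^{deg}` and `p - q ∈ (𝟏,-𝟏)ℝ + (𝟏_{X^c},-𝟏_{X^r})ℝ`. -/
def SlimRel {S : Type*} (μ : S → S → ℝ) (p q : CRSpace S) : Prop :=
  (∃ a : ℝ, p - q = a • shiftVec Set.univ) ∨
  ∃ X ∈ S0 μ, p ∈ Qdeg μ X ∧ q ∈ Qdeg μ X ∧
    ∃ a b : ℝ, p - q = a • shiftVec Set.univ + b • shiftVec X

theorem K_eq_of_sub {S : Type*} {μ : S → S → ℝ} {p q : CRSpace S} {a : ℝ}
    (h : p - q = a • shiftVec Set.univ) : K μ p = K μ q := by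
  have hs : ∀ s t, p (Sum.inl s) + p (Sum.inr t) = q (Sum.inl s) + q (Sum.inr t) := by
    intro s t
    have h₁ := congrFun h (Sum.inl s)
    have h₂ := congrFun h (Sum.inr t)
    simp [shiftVec] at h₁ h₂
    linarith
  ext x y
  simp only [K, hs]

theorem mem_Qdeg_of_sub {S : Type*} {μ : S → S → ℝ} {p q : CRSpace S} {a : ℝ} {X : Set S}
    (hq : q ∈ Q μ) (h : p - q = a • shiftVec Set.univ) (hp : p ∈ Qdeg μ X) : q ∈ Qdeg μ X := by
  have hK := K_eq_of_sub (μ := μ) h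
  obtain ⟨⟨-, h₂⟩, h₃⟩ := hp
  refine ⟨⟨hq, ?_⟩, ?_⟩
  · rw [← hK]; exact h₂
  · simpa only [N, hK] using h₃

theorem QX_unique {S : Type*} {μ : S → S → ℝ} {p : CRSpace S} {X Y : Set S}
    (hX : p ∈ QX μ X) (hY : p ∈ QX μ Y) : X = Y :=
  Set.ext fun s => (hX.2 s).symm.trans (hY.2 s)

/-- The equivalence relation `∼` on `Q_μ^{slim}`. -/
def slimSetoid {S : Type*} (μ : S → S → ℝ) : Setoid (Qslim μ) where
  r p q := SlimRel μ p.1 q.1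
  iseqv := by
    refine ⟨fun p => Or.inl ⟨0, by simp⟩, ?_, ?_⟩
    · rintro p q (⟨a, h⟩ | ⟨X, hX, hp, hq, a, b, h⟩)
      · exact Or.inl ⟨-a, by rw [← neg_sub, h, neg_smul]⟩
      · exact Or.inr ⟨X, hX, hq, hp, -a, -b, by
          rw [← neg_sub, h, neg_smul, neg_smul, neg_add]⟩
    · rintro p q r (⟨a, h⟩ | ⟨X, hX, hp, hq, a, b, h⟩) (⟨a', h'⟩ | ⟨Y, hY, hq', hr, a', b', h'⟩)
      · exact Or.inl ⟨a + a', by rw [← sub_add_sub_cancel, h, h', add_smul]⟩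
      · have hp : p.1 ∈ Qdeg μ Y :=
          mem_Qdeg_of_sub (a := -a) p.2.1 (by rw [← neg_sub, h, neg_smul]) hq'
        exact Or.inr ⟨Y, hY, hp, hr, a + a', b', by
          rw [← sub_add_sub_cancel, h, h', add_smul, add_assoc]⟩
      · exact Or.inr ⟨X, hX, hp, mem_Qdeg_of_sub r.2.1 h' hq, a + a', b, by
          rw [← sub_add_sub_cancel, h, h', add_smul]; abel⟩
      · obtain rfl := QX_unique hq.1 hq'.1
        exact Or.inr ⟨X, hX, hp, hr, a + a', b + b', by
          rw [← sub_add_sub_cancel, h, h', add_smul, add_smul]; abel⟩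

/-- The slimmed tropical polytope `Q_μ^{slim}/∼`. -/
def SlimPolytope {S : Type*} (μ : S → S → ℝ) : Type _ := Quotient (slimSetoid μ)

/-- The projection `Q_μ^{slim} → Q_μ^{slim}/∼`. -/
def slimProj {S : Type*} (μ : S → S → ℝ) (p : Qslim μ) : SlimPolytope μ :=
  Quotient.mk (slimSetoid μ) p

/-- A section: a subset of `Q_μ^{slim}` projected bijectively onto `Q_μ^{slim}/∼`. -/
def IsSection {S : Type*} (μ : S → S → ℝ) (R : Set (CRSpace S)) : Prop :=
  R ⊆ Qslim μ ∧ Set.BijOn (slimProj μ) {p | (p : CRSpace S) ∈ R} Set.univ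

/-- A balanced set: no two of its points satisfy `p^c < q^c` or `p^r < q^r`
(strict inequality in every coordinate). -/
def IsBalanced {S : Type*} (R : Set (CRSpace S)) : Prop :=
  ¬ ∃ p ∈ R, ∃ q ∈ R,
    (∀ s, p (Sum.inl s) < q (Sum.inl s)) ∨ (∀ s, p (Sum.inr s) < q (Sum.inr s))

/-- A slimmed section in `(Q_μ^{slim})^+`: a balanced section such that for no `X ∈ 𝒮₀` there
is a pair of distinct points of `R` in `(Q_{μ,X}^{deg})^+` with `p(s^c) < q(s^c)` for all
`s ∉ X`, or `p(s^r) < q(s^r)` for all `s ∉ X`. -/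
def IsSlimmedSection {S : Type*} (μ : S → S → ℝ) (R : Set (CRSpace S)) : Prop :=
  R ⊆ nonnegPart (Qslim μ) ∧ IsSection μ R ∧ IsBalanced R ∧
  ∀ X ∈ S0 μ, ¬ ∃ p ∈ R ∩ nonnegPart (Qdeg μ X), ∃ q ∈ R ∩ nonnegPart (Qdeg μ X), p ≠ q ∧
    ((∀ s ∉ X, p (Sum.inl s) < q (Sum.inl s)) ∨ (∀ s ∉ X, p (Sum.inr s) < q (Sum.inr s)))

/-! ### Oriented trees -/

/-- An oriented tree: a directed graph without antiparallel edges (and hence without loops)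
whose underlying undirected graph is a tree. -/
structure OrientedTree (V : Type*) extends Digraph V where
  asymm : ∀ u v, Adj u v → ¬ Adj v u
  isTree : toDigraph.toSimpleGraphInclusive.IsTree

/-- The underlying undirected tree. -/
abbrev OrientedTree.graph {V : Type*} (Γ : OrientedTree V) : SimpleGraph V :=
  Γ.toDigraph.toSimpleGraphInclusive

/-- The unique path from `u` to `v` in the underlying tree. -/
def OrientedTree.path {V : Type*} (Γ : OrientedTree V) (u v : V) : Γ.graph.Walk u v :=
  (Γ.isTree.existsUnique_path u v).choose

open Classical in
/-- `D_{Γ,α}(u,v)`: the sum of `α(pq)` over the edges `pq` of `Γ` that the path from `u` to `v`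
traverses from `p` to `q`; edges traversed backwards are not counted. -/
def OrientedTree.dist {V : Type*} (Γ : OrientedTree V) (α : V → V → ℝ) (u v : V) : ℝ :=
  ((Γ.path u v).darts.map fun d => if Γ.Adj d.fst d.snd then α d.fst d.snd else 0).sum

/-- `(Γ, α; {F_s})` is an oriented-tree realization of `μ`. Here `α u v` is the length of the
edge `uv` (its values at non-edges play no role), and a subgraph of `Γ` is recorded by its
underlying undirected subgraph, whose edges inherit their orientations from `Γ`. -/
structure IsRealization {S V : Type*} (μ : S → S → ℝ) (Γ : OrientedTree V) (α : V → V → ℝ)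
    (F : S → Γ.graph.Subgraph) : Prop where
  length_nonneg : ∀ u v, Γ.Adj u v → 0 ≤ α u v
  subtree : ∀ s, (F s).coe.IsTree
  dist_eq : ∀ s t,
    μ s t = sInf {x | ∃ u ∈ (F s).verts, ∃ v ∈ (F t).verts, x = Γ.dist α u v}

/-- The subgraph consists of the single node `v`. -/
def IsNode {V : Type*} {Γ : OrientedTree V} (H : Γ.graph.Subgraph) (v : V) : Prop :=
  H.verts = {v}

/-- The subgraph is a directed path of `Γ`. -/
def IsDirectedPath {V : Type*} {Γ : OrientedTree V} (H : Γ.graph.Subgraph) : Prop :=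
  ∃ (u v : V) (w : Γ.graph.Walk u v), w.IsPath ∧ (∀ d ∈ w.darts, Γ.Adj d.fst d.snd) ∧
    H = w.toSubgraph

/-- The union of the segments `[μ_s, μ_t]` over `s, t` such that `F_s`, `F_t` are single nodes
`v_s`, `v_t` and `v_s v_t` is a (directed) edge of `H`, together with the points `μ_s` where
`F_s` is a single node `v_s` of `H`. The points are redundant unless `H` has a single node. -/
def segmentUnion {S V : Type*} (μ : S → S → ℝ) (Γ : OrientedTree V)
    (F : S → Γ.graph.Subgraph) (H : Γ.graph.Subgraph) : Set (CRSpace S) :=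
  {p | ∃ s v, IsNode (F s) v ∧ v ∈ H.verts ∧ p = pt μ s} ∪
  {p | ∃ s t u v, IsNode (F s) u ∧ IsNode (F t) v ∧ Γ.Adj u v ∧ H.Adj u v ∧
    p ∈ segment ℝ (pt μ s) (pt μ t)}

end DirectedMultiflow

end

noncomputable section

namespace DirectedMultiflow

/-! ### Paths and lengths in oriented trees -/

namespace OrientedTree

open SimpleGraph

variable {V : Type*} (Γ : OrientedTree V) {α : V → V → ℝ}

theorem path_isPath (u v : V) : (Γ.path u v).IsPath :=
  (Γ.isTree.existsUnique_path u v).choose_spec.1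

theorem eq_path {u v : V} {w : Γ.graph.Walk u v} (hw : w.IsPath) : w = Γ.path u v :=
  (Γ.isTree.existsUnique_path u v).choose_spec.2 w hw

theorem path_eq_append {u v x : V} (hx : x ∈ (Γ.path u v).support) :
    Γ.path u v = (Γ.path u x).append (Γ.path x v) := by
  classical
  conv_lhs => rw [← (Γ.path u v).take_spec hx]
  rw [Γ.eq_path ((Γ.path_isPath u v).takeUntil hx), Γ.eq_path ((Γ.path_isPath u v).dropUntil hx)]

theorem path_self (v : V) : Γ.path v v = Walk.nil :=
  (Γ.eq_path Walk.IsPath.nil).symm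

theorem path_adj {u v : V} (h : Γ.graph.Adj u v) : Γ.path u v = Walk.cons h Walk.nil :=
  (Γ.eq_path (by simp [Walk.cons_isPath_iff, h.ne])).symm

theorem mem_support_path_comm {u v x : V} :
    x ∈ (Γ.path u v).support ↔ x ∈ (Γ.path v u).support := by
  rw [← Γ.eq_path (Γ.path_isPath u v).reverse]
  simp

open Classical in
/-- The length of a walk, counting forward edges only. -/
def walkLength (α : V → V → ℝ) {u v : V} (w : Γ.graph.Walk u v) : ℝ :=
  (w.darts.map fun d => if Γ.Adj d.fst d.snd then α d.fst d.snd else 0).sum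

theorem dist_eq_walkLength (u v : V) : Γ.dist α u v = Γ.walkLength α (Γ.path u v) := rfl

theorem walkLength_append {u v x : V} (w : Γ.graph.Walk u v) (w' : Γ.graph.Walk v x) :
    Γ.walkLength α (w.append w') = Γ.walkLength α w + Γ.walkLength α w' := by
  simp [walkLength]

theorem walkLength_nonneg (hα : ∀ u v, Γ.Adj u v → 0 ≤ α u v) {u v : V}
    (w : Γ.graph.Walk u v) : 0 ≤ Γ.walkLength α w := by
  refine List.sum_nonneg fun x hx => ?_
  obtain ⟨d, -, rfl⟩ := List.mem_map.1 hx
  split_ifs with h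
  · exact hα _ _ h
  · exact le_rfl

theorem dist_le_walkLength (hα : ∀ u v, Γ.Adj u v → 0 ≤ α u v) {u v : V}
    (w : Γ.graph.Walk u v) : Γ.dist α u v ≤ Γ.walkLength α w := by
  classical
  rw [dist_eq_walkLength, ← Γ.eq_path w.bypass_isPath]
  refine (w.darts_bypass_sublist_darts.map _).sum_le_sum fun x hx => ?_
  obtain ⟨d, -, rfl⟩ := List.mem_map.1 hx
  split_ifs with h
  · exact hα _ _ h
  · exact le_rfl

theorem dist_nonneg (hα : ∀ u v, Γ.Adj u v → 0 ≤ α u v) (u v : V) : 0 ≤ Γ.dist α u v :=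
  Γ.walkLength_nonneg hα _

theorem dist_self (u : V) : Γ.dist α u u = 0 := by
  simp [dist_eq_walkLength, path_self, walkLength]

theorem dist_eq_add {u v x : V} (hx : x ∈ (Γ.path u v).support) :
    Γ.dist α u v = Γ.dist α u x + Γ.dist α x v := by
  rw [dist_eq_walkLength, Γ.path_eq_append hx, walkLength_append]
  rfl

theorem dist_triangle (hα : ∀ u v, Γ.Adj u v → 0 ≤ α u v) (u v x : V) :
    Γ.dist α u v ≤ Γ.dist α u x + Γ.dist α x v := by
  exact (Γ.dist_le_walkLength hα ((Γ.path u x).append (Γ.path x v))).trans_eq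
    (Γ.walkLength_append _ _)

theorem graph_adj {u v : V} : Γ.graph.Adj u v ↔ Γ.Adj u v ∨ Γ.Adj v u := by
  constructor
  · exact fun h => h.2
  · refine fun h => ⟨?_, h⟩
    rintro rfl
    exact h.elim (fun h => Γ.asymm _ _ h h) fun h => Γ.asymm _ _ h h

open Classical in
theorem dist_adj {u v : V} (h : Γ.graph.Adj u v) :
    Γ.dist α u v = if Γ.Adj u v then α u v else 0 := by
  simp [dist_eq_walkLength, Γ.path_adj h, walkLength]

theorem dist_eq_zero_of_adj {u v : V} (h : Γ.Adj u v) : Γ.dist α v u = 0 := by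
  rw [Γ.dist_adj (Γ.graph_adj.2 (Or.inr h)), if_neg (Γ.asymm _ _ h)]

theorem adj_of_dist_pos {u v : V} (h : Γ.graph.Adj u v) (hd : 0 < Γ.dist α u v) : Γ.Adj u v := by
  classical
  rw [Γ.dist_adj h] at hd
  by_contra hn
  simp [hn] at hd

/-- A directed path costs nothing when it is traversed backwards. -/
theorem dist_eq_zero_of_mem_directed (hα : ∀ u v, Γ.Adj u v → 0 ≤ α u v) {u v x : V}
    (w : Γ.graph.Walk u v) (hw : ∀ d ∈ w.darts, Γ.Adj d.fst d.snd) (hx : x ∈ w.support) :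
    Γ.dist α v x = 0 ∧ Γ.dist α x u = 0 := by
  classical
  have key : ∀ {y z : V} (r : Γ.graph.Walk y z), (∀ d ∈ r.darts, Γ.Adj d.fst d.snd) →
      Γ.dist α z y = 0 := by
    intro y z r
    induction r with
    | nil => exact fun _ => Γ.dist_self _
    | cons h r ih =>
      intro hr
      simp only [Walk.darts_cons, List.mem_cons, forall_eq_or_imp] at hr
      refine le_antisymm ?_ (Γ.dist_nonneg hα _ _)
      have h₁ := ih hr.2
      have h₂ := Γ.dist_eq_zero_of_adj (α := α) hr.1
      exact (Γ.dist_triangle hα _ _ _).trans (by rw [h₁, h₂, add_zero])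
  exact ⟨key (w.dropUntil x hx) fun d hd => hw d (w.darts_dropUntil_subset_darts hx hd),
    key (w.takeUntil x hx) fun d hd => hw d (w.darts_takeUntil_subset_darts hx hd)⟩

/-! ### The two sides of an edge -/

/-- The nodes whose path from `v` passes through `w`. If `vw` is an edge, this is the component
of `w` after the deletion of `vw`. -/
def side (v w : V) : Set V := {z | w ∈ (Γ.path v z).support}

variable {Γ}

theorem mem_side_self (v w : V) : w ∈ Γ.side v w := Walk.end_mem_support _

theorem side_compl {v w : V} (h : Γ.graph.Adj v w) : Γ.side w v = (Γ.side v w)ᶜ := by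
  ext z
  simp only [side, Set.mem_ofPred_eq, Set.mem_compl_iff]
  constructor
  · intro hv hw
    have h₁ := Γ.path_isPath v z
    rw [Γ.path_eq_append hw, Γ.path_adj h] at h₁
    simp only [Walk.cons_append, Walk.nil_append, Walk.cons_isPath_iff] at h₁
    exact h₁.2 hv
  · intro hw
    rw [← Γ.eq_path ((Γ.path_isPath v z).cons (h := h.symm) hw)]
    simp

theorem eq_of_adj_of_mem_side {v w x y : V} (h : Γ.graph.Adj v w) (hxy : Γ.graph.Adj x y)
    (hx : x ∈ Γ.side v w) (hy : y ∉ Γ.side v w) : x = w ∧ y = v := by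
  simp only [side, Set.mem_ofPred_eq] at hx hy
  by_cases hxv : x ∈ (Γ.path v y).support
  · rw [Γ.path_eq_append hxv, Walk.mem_support_append_iff] at hy
    exact (hy (Or.inl hx)).elim
  · have hc := Γ.eq_path ((Γ.path_isPath v y).concat hxv hxy.symm)
    have hxw : x = w := by
      rw [← hc, Walk.support_concat, List.mem_append] at hx
      exact (List.mem_singleton.1 (hx.resolve_left hy)).symm
    subst hxw
    refine ⟨rfl, ?_⟩
    have hl := congrArg Walk.length hc
    rw [Γ.path_adj h, Walk.length_concat, Walk.length_cons, Walk.length_nil] at hl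
    exact (Walk.eq_of_length_eq_zero (Nat.succ_injective hl)).symm

theorem mem_support_of_mem_side {v w x y : V} (h : Γ.graph.Adj v w) (r : Γ.graph.Walk x y)
    (hx : x ∈ Γ.side v w) (hy : y ∉ Γ.side v w) : w ∈ r.support ∧ v ∈ r.support := by
  obtain ⟨d, hd, h₁, h₂⟩ := r.exists_boundary_dart _ hx hy
  obtain ⟨h₃, h₄⟩ := eq_of_adj_of_mem_side h d.adj h₁ h₂
  exact ⟨h₃ ▸ r.dart_fst_mem_support_of_mem_darts hd, h₄ ▸ r.dart_snd_mem_support_of_mem_darts hd⟩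

theorem dist_cross {v w x y : V} (h : Γ.graph.Adj v w) (hx : x ∈ Γ.side v w)
    (hy : y ∈ Γ.side w v) :
    Γ.dist α x y = Γ.dist α x w + Γ.dist α w v + Γ.dist α v y := by
  have hy' : y ∉ Γ.side v w := by rwa [side_compl h] at hy
  rw [Γ.dist_eq_add (mem_support_of_mem_side h (Γ.path x y) hx hy').1, Γ.dist_eq_add hy, add_assoc]

theorem side_subset_side {v w w' : V} (h : Γ.graph.Adj v w) (h' : Γ.graph.Adj v w')
    (hne : w ≠ w') : Γ.side v w' ⊆ Γ.side w v := by
  intro z hz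
  rw [side_compl h]
  intro hz'
  have hw' : w' ∉ Γ.side v w := by
    simp [side, Γ.path_adj h', hne, h.ne']
  have h₁ := (mem_support_of_mem_side h (Γ.path z w') hz' hw').2
  rw [mem_support_path_comm] at h₁
  have h₂ : z ∈ Γ.side w' v := h₁
  rw [side_compl h'] at h₂
  exact h₂ hz

theorem exists_mem_side {v z : V} (hne : z ≠ v) : ∃ w, Γ.graph.Adj v w ∧ z ∈ Γ.side v w := by
  cases hp : Γ.path v z with
  | nil => exact (hne rfl).elim
  | cons h r => exact ⟨_, h, by simp [side, hp]⟩

/-- If every node of a finite tree points to a neighbour, then two adjacent nodes point to each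
other. -/
theorem exists_mutual [Finite V] [Nonempty V] (n : V → V) (hn : ∀ v, Γ.graph.Adj v (n v)) :
    ∃ v, n (n v) = v := by
  obtain ⟨v, hv⟩ := Finite.exists_min fun v => (Γ.side v (n v)).ncard
  refine ⟨v, ?_⟩
  by_contra hne
  have h₁ : Γ.side (n v) (n (n v)) ⊆ Γ.side v (n v) :=
    side_subset_side (hn v).symm (hn (n v)) (Ne.symm hne)
  have h₂ : n v ∉ Γ.side (n v) (n (n v)) := by
    simp [side, path_self, (hn (n v)).ne']
  have h₃ := Set.ncard_lt_ncard (h₁.ssubset_of_mem_notMem (mem_side_self v (n v)) h₂)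
  exact h₃.not_ge (hv (n v))

/-! ### Subtrees -/

variable {T T' : Γ.graph.Subgraph}

theorem adj_of_mem_side (hT : T.coe.IsTree) {v w x y : V} (h : Γ.graph.Adj v w)
    (hx : x ∈ T.verts) (hy : y ∈ T.verts) (hxs : x ∈ Γ.side v w) (hys : y ∉ Γ.side v w) :
    T.Adj v w := by
  obtain ⟨r⟩ := hT.1.preconnected ⟨x, hx⟩ ⟨y, hy⟩
  obtain ⟨d, -, h₁, h₂⟩ := r.exists_boundary_dart (Subtype.val ⁻¹' Γ.side v w) hxs hys
  have hd : T.Adj d.fst d.snd := d.adj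
  obtain ⟨h₃, h₄⟩ := eq_of_adj_of_mem_side h hd.adj_sub h₁ h₂
  rw [h₃, h₄] at hd
  exact hd.symm

theorem adj_of_mem_of_mem (hT : T.coe.IsTree) {v w : V} (h : Γ.graph.Adj v w)
    (hv : v ∈ T.verts) (hw : w ∈ T.verts) : T.Adj v w := by
  refine adj_of_mem_side hT h hw hv (mem_side_self _ _) ?_
  simp [side, path_self, h.ne']

theorem subset_side_or (hT : T.coe.IsTree) {v w : V} (h : Γ.graph.Adj v w) :
    T.verts ⊆ Γ.side v w ∨ T.verts ⊆ Γ.side w v ∨ (v ∈ T.verts ∧ w ∈ T.verts) := by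
  by_cases h₁ : T.verts ⊆ Γ.side v w
  · exact Or.inl h₁
  by_cases h₂ : T.verts ⊆ Γ.side w v
  · exact Or.inr (Or.inl h₂)
  obtain ⟨y, hy, hys⟩ := Set.not_subset.1 h₁
  obtain ⟨x, hx, hxs⟩ := Set.not_subset.1 h₂
  rw [side_compl h, Set.notMem_compl_iff] at hxs
  have := adj_of_mem_side hT h hx hy hxs hys
  exact Or.inr (Or.inr ⟨this.fst_mem, this.snd_mem⟩)

theorem nonempty_verts (hT : T.coe.IsTree) : T.verts.Nonempty :=
  Set.nonempty_coe_sort.1 hT.1.nonempty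

theorem exists_subset_side (hT : T.coe.IsTree) {v z : V} (hv : v ∉ T.verts) (hz : z ∈ T.verts) :
    ∃ w, Γ.graph.Adj v w ∧ T.verts ⊆ Γ.side v w ∧ z ∈ Γ.side v w := by
  obtain ⟨w, h, hw⟩ := exists_mem_side (Γ := Γ) (fun e : z = v => hv (e ▸ hz))
  refine ⟨w, h, ?_, hw⟩
  rcases subset_side_or hT h with h₁ | h₁ | h₁
  · exact h₁
  · have := h₁ hz
    rw [side_compl h] at this
    exact (this hw).elim
  · exact (hv h₁.1).elim

/-- Two disjoint subtrees are separated by an edge leaving the second one. -/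
theorem exists_gate (hT : T.coe.IsTree) (hT' : T'.coe.IsTree)
    (hd : ∀ v ∈ T.verts, v ∉ T'.verts) :
    ∃ w ∈ T'.verts, ∃ w', Γ.graph.Adj w w' ∧ w' ∉ T'.verts ∧ T.verts ⊆ Γ.side w w' ∧
      T'.verts ⊆ Γ.side w' w := by
  obtain ⟨a, ha⟩ := nonempty_verts hT
  obtain ⟨w, hw, hmin⟩ := exists_minimalFor_of_wellFoundedLT (fun b => b ∈ T'.verts)
    (fun b => (Γ.path b a).length) (nonempty_verts hT')
  obtain ⟨w', h, hs, has⟩ := exists_subset_side hT (fun h => hd w h hw) ha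
  have hw' : w' ∉ T'.verts := by
    intro hw'
    have h₁ : Γ.path w a = _ := Γ.path_eq_append has
    have h₂ : (Γ.path w a).length = (Γ.path w' a).length + 1 := by
      rw [h₁, Γ.path_adj h]; simp [add_comm]
    have h₃ := hmin hw' (by simp only; omega)
    simp only at h₃
    omega
  refine ⟨w, hw, w', h, hw', hs, ?_⟩
  rcases subset_side_or hT' h with h₁ | h₁ | h₁
  · have := h₁ hw
    simp [side, path_self, h.ne'] at this
  · exact h₁
  · exact (hw' h₁.2).elim

end OrientedTree

/-! ### Distances realized by subtrees, axiomatically -/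

/-- The combinatorial properties of a distance `μ` realized by subtrees `T s` of a tree with
adjacency relation `E`, where `side v w` is the component of `w` after the deletion of the edge
`vw` and where `T (σ v) = {v}` for every node `v`. They are invariant under reversal of `μ`. -/
structure GateSystem {S V : Type*} (μ : S → S → ℝ) (T : S → Set V) (σ : V → S)
    (E : V → V → Prop) (side : V → V → Set V) : Prop where
  nonneg : ∀ s t, 0 ≤ μ s t
  diag : ∀ s, μ s s = 0
  single : ∀ v, T (σ v) = {v}
  symm : ∀ {v w}, E v w → E w v
  mem_side : ∀ v w, w ∈ side v w
  side_compl : ∀ {v w}, E v w → side w v = (side v w)ᶜ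
  side_subset : ∀ {v w w'}, E v w → E v w' → w ≠ w' → side v w' ⊆ side w v
  direction : ∀ {s v}, v ∉ T s → ∃ w, E v w ∧ T s ⊆ side v w
  subset_or : ∀ {v w} s, E v w → T s ⊆ side v w ∨ T s ⊆ side w v ∨ (v ∈ T s ∧ w ∈ T s)
  gate : ∀ {s t}, (∀ v ∈ T s, v ∉ T t) →
    ∃ w ∈ T t, ∃ w', E w w' ∧ w' ∉ T t ∧ T s ⊆ side w w' ∧ T t ⊆ side w' w
  exists_mutual : ∀ n : V → V, (∀ v, E v (n v)) → ∃ v, n (n v) = v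
  triangle : ∀ s t v, μ s t ≤ μ s (σ v) + μ (σ v) t
  to_mem : ∀ {s v}, v ∈ T s → μ s (σ v) = 0
  of_mem : ∀ {s v}, v ∈ T s → μ (σ v) s = 0
  cross : ∀ {s t v w}, E v w → T s ⊆ side v w → T t ⊆ side w v →
    μ s t = μ s (σ w) + μ (σ w) (σ v) + μ (σ v) t
  one_way : ∀ {v w}, E v w → μ (σ v) (σ w) = 0 ∨ μ (σ w) (σ v) = 0

/-- A nonnegative minimal pair of potentials, that is, a point of `Q_μ^+`. -/
structure IsMinPair {S : Type*} (μ : S → S → ℝ) (a b : S → ℝ) : Prop where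
  nonneg_left : ∀ s, 0 ≤ a s
  nonneg_right : ∀ s, 0 ≤ b s
  le_add : ∀ s t, μ s t ≤ a s + b t
  exists_right : ∀ s, ∃ t, a s + b t = μ s t
  exists_left : ∀ t, ∃ s, a s + b t = μ s t

theorem IsMinPair.flip {S : Type*} {μ : S → S → ℝ} {a b : S → ℝ} (h : IsMinPair μ a b) :
    IsMinPair (flip μ) b a where
  nonneg_left := h.nonneg_right
  nonneg_right := h.nonneg_left
  le_add s t := (h.le_add t s).trans_eq (add_comm _ _)
  exists_right s := (h.exists_left s).imp fun _ h => (add_comm _ _).trans h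
  exists_left t := (h.exists_right t).imp fun _ h => (add_comm _ _).trans h

namespace GateSystem

variable {S V : Type*} {μ : S → S → ℝ} {T : S → Set V} {σ : V → S} {E : V → V → Prop}
  {side : V → V → Set V} {a b : S → ℝ}

theorem flip (H : GateSystem μ T σ E side) : GateSystem (flip μ) T σ E side where
  nonneg s t := H.nonneg t s
  diag := H.diag
  single := H.single
  symm := H.symm
  mem_side := H.mem_side
  side_compl := H.side_compl
  side_subset := H.side_subset
  direction := H.direction
  subset_or := H.subset_or
  gate := H.gate
  exists_mutual := H.exists_mutual
  triangle s t v := (H.triangle t s v).trans_eq (add_comm _ _)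
  to_mem := H.of_mem
  of_mem := H.to_mem
  cross h hs ht := (H.cross (H.symm h) ht hs).trans (by simp only [_root_.flip]; ring)
  one_way h := (H.one_way h).symm

variable (H : GateSystem μ T σ E side)
include H

theorem single_subset {v w : V} : T (σ w) ⊆ side v w := by
  rw [H.single, Set.singleton_subset_iff]
  exact H.mem_side v w

theorem dist_add_of_ne {s t : S} {v w w' : V} (h : E v w) (h' : E v w') (hne : w ≠ w')
    (hs : T s ⊆ side v w) (ht : T t ⊆ side v w') : μ s t = μ s (σ v) + μ (σ v) t := by
  rw [H.cross h hs (ht.trans (H.side_subset h h' hne)), H.cross h hs H.single_subset, H.diag,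
    add_zero]

theorem dist_of_subset {s : S} {v w : V} (h : E v w) (hs : T s ⊆ side v w) :
    μ s (σ v) = μ s (σ w) + μ (σ w) (σ v) := by
  rw [H.cross h hs H.single_subset, H.diag, add_zero]

theorem notMem_of_subset {s : S} {v w : V} (h : E v w) (hs : T s ⊆ side v w) : v ∉ T s := by
  intro hv
  have h₁ := hs hv
  rw [H.side_compl (H.symm h)] at h₁
  exact h₁ (H.mem_side w v)

theorem exists_pointer (hp : IsMinPair μ a b) {v : V} (hv : 0 < a (σ v)) :
    ∃ w t, E v w ∧ T t ⊆ side v w ∧ a (σ v) + b t = μ (σ v) t := by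
  obtain ⟨t, ht⟩ := hp.exists_right (σ v)
  have : v ∉ T t := fun h => by
    rw [H.of_mem h] at ht
    linarith [hp.nonneg_right t]
  obtain ⟨w, h, hs⟩ := H.direction this
  exact ⟨w, t, h, hs, ht⟩

theorem pointer_mem (hp : IsMinPair μ a b) {x t : S} {w w' : V} (hx : a x = 0) (hw : w ∈ T x)
    (hpos : 0 < a (σ w)) (h : E w w') (ht : T t ⊆ side w w')
    (he : a (σ w) + b t = μ (σ w) t) : w' ∈ T x := by
  rcases H.subset_or x h with h₁ | h₁ | h₁
  · exact (H.notMem_of_subset h h₁ hw).elim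
  · have h₂ := H.cross (H.symm h) h₁ ht
    have h₃ := H.cross (H.symm h) (H.single_subset (v := w') (w := w)) ht
    rw [H.to_mem hw] at h₂
    rw [H.diag] at h₃
    linarith [hp.le_add x t]
  · exact h₁.2

theorem exists_zero_of_tight (hp : IsMinPair μ a b) {x s : S} (hx : a x = 0)
    (he : a s + b x = μ s x) (hpos : 0 < μ s x) : ∃ w, a (σ w) = 0 := by
  have hd : ∀ v ∈ T s, v ∉ T x := fun v hs hx' => by
    have := H.triangle s x v
    rw [H.to_mem hs, H.of_mem hx'] at this
    linarith
  obtain ⟨w, hw, w', h, hw', hs, hxs⟩ := H.gate hd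
  refine ⟨w, ?_⟩
  by_contra hne
  have hpos' := lt_of_le_of_ne (hp.nonneg_left (σ w)) (Ne.symm hne)
  obtain ⟨w'', t, h', ht, ht'⟩ := H.exists_pointer hp hpos'
  have hw'' := H.pointer_mem hp hx hw hpos' h' ht ht'
  have h₁ := H.dist_add_of_ne h h' (fun e => hw' (e ▸ hw'')) hs ht
  have h₃ := hp.le_add s t
  have h₄ := H.cross h hs hxs
  have h₅ := H.dist_of_subset h hs
  rw [H.of_mem hw] at h₄
  linarith [hp.nonneg_right x]

/-- Two nodes that point to each other exclude zeros of `a` on nodes. -/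
theorem pos_of_mutual (hp : IsMinPair μ a b) {u v : V} {t t' : S} (h : E u v)
    (ht : T t ⊆ side v u) (he : a (σ v) + b t = μ (σ v) t) (hv : 0 < a (σ v))
    (ht' : T t' ⊆ side u v) (he' : a (σ u) + b t' = μ (σ u) t') (hu : 0 < a (σ u)) (w : V) :
    0 < a (σ w) := by
  have key : ∀ {u v : V} {t : S}, E u v → T t ⊆ side v u → a (σ v) + b t = μ (σ v) t →
      0 < a (σ v) → w ∈ side u v → 0 < a (σ w) := by
    intro u v t h ht he hv hw
    have h₁ := H.cross (s := σ w) h (by rwa [H.single, Set.singleton_subset_iff]) ht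
    have h₂ := H.cross (s := σ v) h H.single_subset ht
    rw [H.diag] at h₂
    linarith [hp.le_add (σ w) t, H.nonneg (σ w) (σ v)]
  by_cases hw : w ∈ side u v
  · exact key h ht he hv hw
  · refine key (H.symm h) ht' he' hu ?_
    rw [H.side_compl h]
    exact hw

theorem exists_of_forall_pos (hp : IsMinPair μ a b) (hpos : ∀ v, 0 < a (σ v)) :
    ∃ u, ∀ s, a s + b (σ u) = μ s (σ u) → a s = 0 := by
  choose n τ hE hτ he using fun v => H.exists_pointer hp (hpos v)
  obtain ⟨v₀, hv₀⟩ := H.exists_mutual n hE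
  have key : ∀ {u v : V} {t t' : S}, E u v → μ (σ v) (σ u) = 0 → T t ⊆ side v u →
      a (σ v) + b t = μ (σ v) t → T t' ⊆ side u v → a (σ u) + b t' = μ (σ u) t' →
      ∃ u, ∀ s, a s + b (σ u) = μ s (σ u) → a s = 0 := by
    intro u v t t' h h0 ht he ht' he'
    refine ⟨u, fun s hs => ?_⟩
    have hmem : u ∈ T s := by
      by_contra hu
      obtain ⟨w, h', hw⟩ := H.direction hu
      by_cases hwv : w = v
      · subst hwv
        have h₁ := H.cross h hw ht
        have h₂ := H.dist_of_subset h hw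
        have h₃ := H.cross (s := σ w) h H.single_subset ht
        rw [H.diag] at h₃
        linarith [hp.le_add s t, hpos w, hp.nonneg_right (σ u)]
      · have h₁ := H.dist_add_of_ne h' h hwv hw ht'
        linarith [hp.le_add s t', hpos u, hp.nonneg_right (σ u)]
    rw [H.to_mem hmem] at hs
    linarith [hp.nonneg_left s, hp.nonneg_right (σ u)]
  have h := hE v₀
  have hτ' := hτ (n v₀)
  rw [hv₀] at hτ'
  rcases H.one_way h with h0 | h0
  · exact key (H.symm h) h0 (hτ v₀) (he v₀) hτ' (he _)
  · exact key h h0 hτ' (he _) (hτ v₀) (he v₀)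

/-- The combinatorial core of "no zero on a node implies proper fat". -/
theorem fat_of_forall_pos (hp : IsMinPair μ a b) (hpos : ∀ v, 0 < a (σ v)) :
    (∀ s x, a x = 0 → b x = 0 → a s + b x = μ s x → a s = 0 ∧ b s = 0) ∧
    ∃ u, 0 < a (σ u) ∧ ∀ s, a s + b (σ u) = μ s (σ u) → a s = 0 ∧ b s = 0 := by
  have hb : ∀ s, a s = 0 → b s = 0 := by
    intro s hs
    by_contra hne
    have hb := lt_of_le_of_ne (hp.nonneg_right s) (Ne.symm hne)
    obtain ⟨s', hs'⟩ := hp.exists_left s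
    obtain ⟨w, hw⟩ := H.exists_zero_of_tight hp hs hs' (by linarith [hp.nonneg_left s'])
    exact (hpos w).ne' hw
  refine ⟨fun s x hx hx' he => ?_, ?_⟩
  · have : a s = 0 := by
      by_contra hne
      have ha := lt_of_le_of_ne (hp.nonneg_left s) (Ne.symm hne)
      obtain ⟨w, hw⟩ := H.exists_zero_of_tight hp hx he (by linarith)
      exact (hpos w).ne' hw
    exact ⟨this, hb s this⟩
  · obtain ⟨u, hu⟩ := H.exists_of_forall_pos hp hpos
    exact ⟨u, hpos u, fun s hs => ⟨hu s hs, hb s (hu s hs)⟩⟩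

/-- A point with zeros on nodes in both parts that is not a vertex lies in the interior of an
edge. -/
theorem exists_edge (hp : IsMinPair μ a b) (hpos : ∀ v, 0 < a (σ v) + b (σ v))
    (ha : ∃ v, a (σ v) = 0) (hb : ∃ v, b (σ v) = 0) :
    ∃ u v, E u v ∧ μ (σ v) (σ u) = 0 ∧ a (σ v) = 0 ∧ b (σ u) = 0 ∧ 0 < a (σ u) ∧
      0 < b (σ v) ∧ a (σ u) + b (σ v) = μ (σ u) (σ v) := by
  have hpt : ∀ v, ∃ n, E v n ∧
      ((0 < a (σ v) ∧ ∃ t, T t ⊆ side v n ∧ a (σ v) + b t = μ (σ v) t) ∨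
        (0 < b (σ v) ∧ ∃ s, T s ⊆ side v n ∧ a s + b (σ v) = μ s (σ v))) := by
    intro v
    rcases (hp.nonneg_left (σ v)).lt_or_eq with h | h
    · obtain ⟨w, t, h₁, h₂, h₃⟩ := H.exists_pointer hp h
      exact ⟨w, h₁, Or.inl ⟨h, t, h₂, h₃⟩⟩
    · have h' : 0 < b (σ v) := by linarith [hpos v]
      obtain ⟨w, s, h₁, h₂, h₃⟩ := H.flip.exists_pointer hp.flip h'
      exact ⟨w, h₁, Or.inr ⟨h', s, h₂, (add_comm _ _).trans h₃⟩⟩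
  have noA : ∀ {u v : V} {t t' : S}, E u v → 0 < a (σ v) → 0 < a (σ u) → T t ⊆ side v u →
      a (σ v) + b t = μ (σ v) t → T t' ⊆ side u v → a (σ u) + b t' = μ (σ u) t' → False := by
    intro u v t t' h hv hu ht he ht' he'
    obtain ⟨w, hw⟩ := ha
    exact (H.pos_of_mutual hp h ht he hv ht' he' hu w).ne' hw
  have noB : ∀ {u v : V} {s s' : S}, E u v → 0 < b (σ v) → 0 < b (σ u) → T s ⊆ side v u →
      a s + b (σ v) = μ s (σ v) → T s' ⊆ side u v → a s' + b (σ u) = μ s' (σ u) → False := by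
    intro u v s s' h hv hu hs he hs' he'
    obtain ⟨w, hw⟩ := hb
    exact (H.flip.pos_of_mutual hp.flip h hs ((add_comm _ _).trans he) hv hs'
      ((add_comm _ _).trans he') hu w).ne' hw
  have opp : ∀ {v w w' : V} {s t : S}, E v w → E v w' → w ≠ w' → T s ⊆ side v w →
      T t ⊆ side v w' → a s + b (σ v) = μ s (σ v) → a (σ v) + b t = μ (σ v) t → False := by
    intro v w w' s t h h' hne hs ht he he'
    linarith [H.dist_add_of_ne h h' hne hs ht, hp.le_add s t, hpos v]
  have key : ∀ {u v : V} {s t : S}, E u v → 0 < a (σ u) → 0 < b (σ v) → T t ⊆ side u v →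
      a (σ u) + b t = μ (σ u) t → T s ⊆ side v u → a s + b (σ v) = μ s (σ v) →
      ∃ u v, E u v ∧ μ (σ v) (σ u) = 0 ∧ a (σ v) = 0 ∧ b (σ u) = 0 ∧ 0 < a (σ u) ∧
        0 < b (σ v) ∧ a (σ u) + b (σ v) = μ (σ u) (σ v) := by
    intro u v s t h hu hv ht he hs he'
    have h₁ := H.cross (H.symm h) hs ht
    have h₂ := H.dist_of_subset (H.symm h) hs
    have h₃ := H.cross (s := σ u) (H.symm h) H.single_subset ht
    rw [H.diag] at h₃
    have h₄ := hp.le_add s t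
    have h₅ := hp.le_add (σ u) (σ v)
    refine ⟨u, v, h, ?_, ?_, ?_, hu, hv, by linarith⟩
    · exact (H.one_way h).resolve_left fun h0 => by linarith
    · by_contra hne
      have hav := lt_of_le_of_ne (hp.nonneg_left (σ v)) (Ne.symm hne)
      obtain ⟨w, t', h', ht', het'⟩ := H.exists_pointer hp hav
      by_cases hw : u = w
      · subst hw
        exact noA h hav hu ht' het' ht he
      · exact opp (H.symm h) h' hw hs ht' he' het'
    · by_contra hne
      have hbu := lt_of_le_of_ne (hp.nonneg_right (σ u)) (Ne.symm hne)
      obtain ⟨w, s', h', hs', hes'⟩ := H.flip.exists_pointer hp.flip hbu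
      replace hes' : a s' + b (σ u) = μ s' (σ u) := (add_comm _ _).trans hes'
      by_cases hw : w = v
      · subst hw
        exact noB h hv hbu hs he' hs' hes'
      · exact opp h' h hw hs' ht hes' he
  choose n hE hn using hpt
  obtain ⟨v, hv⟩ := H.exists_mutual n hE
  have hn' := hn (n v)
  have h := hE v
  rw [hv] at hn'
  rcases hn v with ⟨hu, t, ht, he⟩ | ⟨hu, t, ht, he⟩ <;>
    rcases hn' with ⟨hu', t', ht', he'⟩ | ⟨hu', t', ht', he'⟩
  · exact (noA h hu' hu ht' he' ht he).elim
  · exact key h hu hu' ht he ht' he'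
  · exact key (H.symm h) hu' hu ht' he' ht he
  · exact (noB h hu' hu ht' he' ht he).elim

/-- Bounds at an edge `uv`, with coefficients cleared of the parameter. -/
theorem edge_le (hp : IsMinPair μ a b) {u v : V} (h : E u v) (h0 : μ (σ v) (σ u) = 0)
    (ha : a (σ v) = 0) (hb : b (σ u) = 0) (he : a (σ u) + b (σ v) = μ (σ u) (σ v))
    {c : ℝ} (hc : c * μ (σ u) (σ v) = a (σ u)) (s : S) :
    (1 - c) * μ s (σ u) + c * μ s (σ v) ≤ a s ∧
      (1 - c) * μ (σ u) s + c * μ (σ v) s ≤ b s := by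
  have h₁ := hp.le_add s (σ u)
  have h₂ := hp.le_add s (σ v)
  have h₃ := hp.le_add (σ u) s
  have h₄ := hp.le_add (σ v) s
  rcases H.subset_or s h with hs | hs | ⟨hu, hv⟩
  · have e₁ := H.dist_of_subset h hs
    have e₂ := H.flip.dist_of_subset h hs
    simp only [_root_.flip] at e₂
    rw [h0, add_zero] at e₁
    rw [e₁, e₂]
    constructor <;> linarith
  · have e₁ := H.dist_of_subset (H.symm h) hs
    have e₂ := H.flip.dist_of_subset (H.symm h) hs
    simp only [_root_.flip] at e₂
    rw [h0, add_zero] at e₂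
    rw [e₁, e₂]
    constructor <;> linarith
  · rw [H.to_mem hu, H.to_mem hv, H.of_mem hu, H.of_mem hv]
    simpa using ⟨hp.nonneg_left s, hp.nonneg_right s⟩

/-- Every element has a tight partner at a point of the edge `uv`. -/
theorem edge_tight {u v : V} (h : E u v) (h0 : μ (σ v) (σ u) = 0) (c : ℝ) (s : S) :
    ∃ t, ((1 - c) * μ s (σ u) + c * μ s (σ v)) + ((1 - c) * μ (σ u) t + c * μ (σ v) t) =
      μ s t := by
  rcases H.subset_or s h with hs | hs | ⟨hu, hv⟩
  · have e₁ := H.dist_of_subset h hs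
    refine ⟨σ u, ?_⟩
    rw [h0, add_zero] at e₁
    rw [e₁, H.diag, h0]
    ring
  · have e₁ := H.dist_of_subset (H.symm h) hs
    refine ⟨σ v, ?_⟩
    rw [e₁, H.diag]
    ring
  · refine ⟨σ u, ?_⟩
    rw [H.to_mem hu, H.to_mem hv, H.diag, h0]
    ring

/-- An element of the region of an interior point of the edge `uv` contains that edge. -/
theorem mem_of_edge (hp : IsMinPair μ a b) {u v : V} (h : E u v)
    (hu : 0 < a (σ u)) (hv : 0 < b (σ v)) (he : a (σ u) + b (σ v) = μ (σ u) (σ v)) {s : S}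
    (hs : a s = 0) (hs' : b s = 0) : u ∈ T s ∧ v ∈ T s := by
  rcases H.subset_or s h with h₁ | h₁ | h₁
  · have e₂ := H.flip.dist_of_subset h h₁
    simp only [_root_.flip] at e₂
    linarith [hp.le_add (σ u) s, H.nonneg (σ v) s]
  · have e₁ := H.dist_of_subset (H.symm h) h₁
    linarith [hp.le_add s (σ v), H.nonneg s (σ u)]
  · exact h₁

theorem vertex_eq (hp : IsMinPair μ a b) {v : V} (ha : a (σ v) = 0) (hb : b (σ v) = 0) (s : S) :
    a s = μ s (σ v) ∧ b s = μ (σ v) s := by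
  have h₁ := fun s => hp.le_add s (σ v)
  have h₂ := fun s => hp.le_add (σ v) s
  obtain ⟨t, ht⟩ := hp.exists_right s
  obtain ⟨t', ht'⟩ := hp.exists_left s
  constructor
  · linarith [h₁ s, h₂ t, H.triangle s t v]
  · linarith [h₂ s, h₁ t', H.triangle t' s v]

theorem edge_eq (hp : IsMinPair μ a b) {u v : V} (h : E u v) (h0 : μ (σ v) (σ u) = 0)
    (ha : a (σ v) = 0) (hb : b (σ u) = 0) (he : a (σ u) + b (σ v) = μ (σ u) (σ v))
    {c : ℝ} (hc₀ : 0 ≤ c) (hc₁ : c ≤ 1) (hc : c * μ (σ u) (σ v) = a (σ u)) (s : S) :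
    a s = (1 - c) * μ s (σ u) + c * μ s (σ v) ∧
      b s = (1 - c) * μ (σ u) s + c * μ (σ v) s := by
  have key := H.edge_le hp h h0 ha hb he hc
  have tri : ∀ s t, μ s t ≤ ((1 - c) * μ s (σ u) + c * μ s (σ v)) +
      ((1 - c) * μ (σ u) t + c * μ (σ v) t) := fun s t => by
    have h₁ := mul_le_mul_of_nonneg_left (H.triangle s t u) (sub_nonneg.2 hc₁)
    have h₂ := mul_le_mul_of_nonneg_left (H.triangle s t v) hc₀
    linarith
  obtain ⟨t, ht⟩ := hp.exists_right s
  obtain ⟨t', ht'⟩ := hp.exists_left s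
  constructor
  · linarith [(key s).1, (key t).2, tri s t]
  · linarith [(key s).2, (key t').1, tri t' s]

theorem dist_eq_of_zero {v w : V} (h : μ (σ v) (σ w) = 0) (h' : μ (σ w) (σ v) = 0) (t : S) :
    μ (σ v) t = μ (σ w) t ∧ μ t (σ v) = μ t (σ w) := by
  have h₁ := H.triangle (σ v) t w
  have h₂ := H.triangle (σ w) t v
  have h₃ := H.triangle t (σ v) w
  have h₄ := H.triangle t (σ w) v
  constructor <;> linarith

theorem exists_mem_of_zero {s : S} {v : V} (h : μ s (σ v) = 0) (h' : μ (σ v) s = 0) :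
    ∃ w ∈ T s, μ (σ v) (σ w) = 0 ∧ μ (σ w) (σ v) = 0 := by
  by_cases hv : v ∈ T s
  · exact ⟨v, hv, H.diag _, H.diag _⟩
  · obtain ⟨w, hw, w', hE, -, hs, hs'⟩ := H.gate (s := σ v) (t := s)
      (fun x hx => by rw [H.single, Set.mem_singleton_iff] at hx; rwa [hx])
    have e₁ := H.cross hE hs hs'
    have e₂ := H.cross (H.symm hE) hs' hs
    have e₃ := H.dist_of_subset hE hs
    have e₄ := H.flip.dist_of_subset hE hs
    simp only [_root_.flip] at e₄
    rw [H.of_mem hw] at e₁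
    rw [H.to_mem hw] at e₂
    exact ⟨w, hw, by linarith, by linarith⟩

end GateSystem

/-! ### Minimal points, the graph `K(p)` and shifts -/

section

variable {S : Type*} {μ : S → S → ℝ} {p q : CRSpace S}

theorem K_adj {s t : S} :
    (K μ p).Adj (Sum.inl s) (Sum.inr t) ↔ p (Sum.inl s) + p (Sum.inr t) = μ s t := by
  simp [K]

theorem N_inl (A : Set S) :
    N μ p (Sum.inl '' A) =
      Sum.inr '' {t | ∃ s ∈ A, p (Sum.inl s) + p (Sum.inr t) = μ s t} := by
  ext (x | x) <;> simp [N, K]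

theorem N_inr (A : Set S) :
    N μ p (Sum.inr '' A) =
      Sum.inl '' {s | ∃ t ∈ A, p (Sum.inl s) + p (Sum.inr t) = μ s t} := by
  ext (x | x) <;> simp [N, K]

theorem mem_Q_iff [Finite S] :
    p ∈ Q μ ↔ p ∈ P μ ∧ (∀ s, ∃ t, p (Sum.inl s) + p (Sum.inr t) = μ s t) ∧
      ∀ t, ∃ s, p (Sum.inl s) + p (Sum.inr t) = μ s t := by
  classical
  constructor
  · intro hp
    refine ⟨hp.1, fun s => ?_, fun t => ?_⟩
    · have : Nonempty S := ⟨s⟩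
      obtain ⟨t, ht⟩ := Finite.exists_min fun t => p (Sum.inl s) + p (Sum.inr t) - μ s t
      refine ⟨t, ?_⟩
      set δ := p (Sum.inl s) + p (Sum.inr t) - μ s t with hδ
      have hδ0 : 0 ≤ δ := sub_nonneg.2 (hp.1 s t)
      have hq : Function.update p (Sum.inl s) (p (Sum.inl s) - δ) ∈ P μ := by
        intro s' t'
        by_cases hs : s' = s
        · subst hs
          simp only [Function.update_self, ne_eq, reduceCtorEq, not_false_eq_true,
            Function.update_of_ne]
          linarith [ht t']
        · simpa [Function.update_of_ne, hs] using hp.1 s' t'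
      have hle := hp.2 hq (update_le_self_iff.2 (by linarith)) (Sum.inl s)
      simp only [Function.update_self] at hle
      linarith
    · have : Nonempty S := ⟨t⟩
      obtain ⟨s, hs⟩ := Finite.exists_min fun s => p (Sum.inl s) + p (Sum.inr t) - μ s t
      refine ⟨s, ?_⟩
      set δ := p (Sum.inl s) + p (Sum.inr t) - μ s t with hδ
      have hδ0 : 0 ≤ δ := sub_nonneg.2 (hp.1 s t)
      have hq : Function.update p (Sum.inr t) (p (Sum.inr t) - δ) ∈ P μ := by
        intro s' t'
        by_cases ht : t' = t
        · subst ht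
          simp only [Function.update_self, ne_eq, reduceCtorEq, not_false_eq_true,
            Function.update_of_ne]
          linarith [hs s']
        · simpa [Function.update_of_ne, ht] using hp.1 s' t'
      have hle := hp.2 hq (update_le_self_iff.2 (by linarith)) (Sum.inr t)
      simp only [Function.update_self] at hle
      linarith
  · rintro ⟨hP, h₁, h₂⟩
    refine ⟨hP, fun q hq hle => ?_⟩
    rintro (s | t)
    · obtain ⟨t, ht⟩ := h₁ s
      linarith [hq s t, hle (Sum.inr t)]
    · obtain ⟨s, hs⟩ := h₂ t
      linarith [hq s t, hle (Sum.inl s)]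

theorem mem_nonnegPart_Q_iff [Finite S] :
    p ∈ nonnegPart (Q μ) ↔ IsMinPair μ (fun s => p (Sum.inl s)) fun s => p (Sum.inr s) := by
  constructor
  · rintro ⟨hQ, h0⟩
    rw [mem_Q_iff] at hQ
    exact ⟨fun _ => h0 _, fun _ => h0 _, hQ.1, hQ.2.1, hQ.2.2⟩
  · intro h
    refine ⟨mem_Q_iff.2 ⟨h.le_add, h.exists_right, h.exists_left⟩, ?_⟩
    rintro (s | s)
    exacts [h.nonneg_left s, h.nonneg_right s]

theorem shift_add (c : ℝ) (s t : S) :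
    (p + c • shiftVec Set.univ : CRSpace S) (Sum.inl s) +
      (p + c • shiftVec Set.univ : CRSpace S) (Sum.inr t) =
      p (Sum.inl s) + p (Sum.inr t) := by
  simp only [shiftVec, Pi.add_apply, Pi.smul_apply, Sum.elim_inl, Sum.elim_inr,
    Set.indicator_univ, smul_eq_mul]
  ring

theorem shift_mem_Q [Finite S] (hp : p ∈ Q μ) (c : ℝ) : p + c • shiftVec Set.univ ∈ Q μ := by
  rw [mem_Q_iff] at hp ⊢
  refine ⟨fun s t => ?_, ?_⟩
  · rw [shift_add]; exact hp.1 s t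
  · simpa only [shift_add] using hp.2

theorem mem_QX_of_K_eq (hq : q ∈ Q μ) (h : K μ p = K μ q) {X : Set S} (hp : p ∈ QX μ X) :
    q ∈ QX μ X :=
  ⟨hq, h ▸ hp.2⟩

theorem mem_Qdeg_of_K_eq (hq : q ∈ Q μ) (h : K μ p = K μ q) {X : Set S} (hp : p ∈ Qdeg μ X) :
    q ∈ Qdeg μ X := by
  refine ⟨mem_QX_of_K_eq hq h hp.1, ?_⟩
  simpa only [N, h] using hp.2

theorem isFat_of_K_eq (hq : q ∈ Q μ) (h : K μ p = K μ q) (hp : IsFat μ p) : IsFat μ q := by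
  obtain ⟨X, hX, hpX, hN⟩ := hp
  refine ⟨X, hX, mem_QX_of_K_eq hq h hpX, ?_⟩
  simpa only [N, h] using hN

theorem isProperFat_of_K_eq (hp : p ∈ Q μ) (hq : q ∈ Q μ) (h : K μ p = K μ q)
    (hf : IsProperFat μ p) : IsProperFat μ q :=
  ⟨isFat_of_K_eq hq h hf.1, fun X hX hqX => hf.2 X hX (mem_Qdeg_of_K_eq hp h.symm hqX)⟩

/-! ### Fats among nonnegative points -/

theorem mem_QX_iff (hμ : ∀ s, μ s s = 0) (hp : p ∈ nonnegPart (Q μ)) {X : Set S} :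
    p ∈ QX μ X ↔ X = {s | p (Sum.inl s) = 0 ∧ p (Sum.inr s) = 0} := by
  have key : ∀ s, (K μ p).Adj (Sum.inl s) (Sum.inr s) ↔
      p (Sum.inl s) = 0 ∧ p (Sum.inr s) = 0 := fun s => by
    rw [K_adj, hμ, add_eq_zero_iff_of_nonneg (hp.2 _) (hp.2 _)]
  constructor
  · exact fun h => Set.ext fun s => (h.2 s).symm.trans (key s)
  · rintro rfl
    exact ⟨hp.1, key⟩

theorem zero_mem_S0 (hμ : ∀ s t, 0 ≤ μ s t) (hp : p ∈ P μ) :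
    {s | p (Sum.inl s) = 0 ∧ p (Sum.inr s) = 0} ∈ S0 μ := by
  intro s hs t ht
  have := hp s t
  rw [hs.1, ht.2, add_zero] at this
  exact le_antisymm this (hμ s t)

theorem isProperFat_of_left (hμ : IsDirectedDistance μ) (hp : p ∈ nonnegPart (Q μ))
    (h₁ : ∀ s x, p (Sum.inl x) = 0 → p (Sum.inr x) = 0 →
      p (Sum.inl s) + p (Sum.inr x) = μ s x → p (Sum.inl s) = 0 ∧ p (Sum.inr s) = 0)
    (h₂ : ∃ u, 0 < p (Sum.inl u) ∧ (∃ s, p (Sum.inl s) + p (Sum.inr u) = μ s u) ∧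
      ∀ s, p (Sum.inl s) + p (Sum.inr u) = μ s u → p (Sum.inl s) = 0 ∧ p (Sum.inr s) = 0) :
    IsProperFat μ p := by
  refine ⟨⟨_, zero_mem_S0 hμ.nonneg hp.1.1, (mem_QX_iff hμ.diag hp).2 rfl, Or.inl ?_⟩, ?_⟩
  · rw [N_inl]
    refine Set.image_mono ?_
    rintro t ⟨s, hs, he⟩ ht
    exact hs (h₁ s t ht.1 ht.2 he)
  · rintro X - ⟨hX, hN⟩
    rw [mem_QX_iff hμ.diag hp] at hX
    obtain ⟨u, hu, ⟨s, hs⟩, h⟩ := h₂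
    have huX : u ∈ Xᶜ := fun h => hu.ne' (by rw [hX] at h; exact h.1)
    rw [N_inl, N_inr, Set.image_eq_image Sum.inr_injective,
      Set.image_eq_image Sum.inl_injective] at hN
    rcases hN with hN | hN
    · rw [← hN] at huX
      obtain ⟨s, hsX, hs⟩ := huX
      exact hsX (by rw [hX]; exact h s hs)
    · have : s ∈ Xᶜ := by rw [← hN]; exact ⟨u, huX, hs⟩
      exact this (by rw [hX]; exact h s hs)

theorem isProperFat_of_right (hμ : IsDirectedDistance μ) (hp : p ∈ nonnegPart (Q μ))
    (h₁ : ∀ s x, p (Sum.inl x) = 0 → p (Sum.inr x) = 0 →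
      p (Sum.inl x) + p (Sum.inr s) = μ x s → p (Sum.inl s) = 0 ∧ p (Sum.inr s) = 0)
    (h₂ : ∃ u, 0 < p (Sum.inr u) ∧ (∃ s, p (Sum.inl u) + p (Sum.inr s) = μ u s) ∧
      ∀ s, p (Sum.inl u) + p (Sum.inr s) = μ u s → p (Sum.inl s) = 0 ∧ p (Sum.inr s) = 0) :
    IsProperFat μ p := by
  refine ⟨⟨_, zero_mem_S0 hμ.nonneg hp.1.1, (mem_QX_iff hμ.diag hp).2 rfl, Or.inr ?_⟩, ?_⟩
  · rw [N_inr]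
    refine Set.image_mono ?_
    rintro t ⟨s, hs, he⟩ ht
    exact hs (h₁ s t ht.1 ht.2 he)
  · rintro X - ⟨hX, hN⟩
    rw [mem_QX_iff hμ.diag hp] at hX
    obtain ⟨u, hu, ⟨s, hs⟩, h⟩ := h₂
    have huX : u ∈ Xᶜ := fun h => hu.ne' (by rw [hX] at h; exact h.2)
    rw [N_inl, N_inr, Set.image_eq_image Sum.inr_injective,
      Set.image_eq_image Sum.inl_injective] at hN
    rcases hN with hN | hN
    · have : s ∈ Xᶜ := by rw [← hN]; exact ⟨u, huX, hs⟩
      exact this (by rw [hX]; exact h s hs)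
    · rw [← hN] at huX
      obtain ⟨s, hsX, hs⟩ := huX
      exact hsX (by rw [hX]; exact h s hs)

theorem not_isProperFat_of_forall_zero (hμ : ∀ s t, μ s t = 0) (hp : p ∈ Q μ)
    (h : p = 0) : ¬ IsProperFat μ p := by
  refine fun hf => hf.2 Set.univ (fun _ _ _ _ => hμ _ _) ⟨⟨hp, fun s => ?_⟩, Or.inl ?_⟩
  · simp [K_adj, h, hμ]
  · simp [N]

theorem not_isProperFat_of_forall_ne [Finite S] (hμ : ∀ s, μ s s = 0) (hp : p ∈ nonnegPart (Q μ))
    (h : ∀ s, ¬ (p (Sum.inl s) = 0 ∧ p (Sum.inr s) = 0)) : ¬ IsProperFat μ p := by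
  refine fun hf => hf.2 ∅ (fun _ h => h.elim) ⟨(mem_QX_iff hμ hp).2 ?_, Or.inl ?_⟩
  · exact (Set.eq_empty_of_forall_notMem h).symm
  · rw [N_inl, Set.compl_empty, Set.image_eq_image Sum.inr_injective]
    exact Set.eq_univ_of_forall fun t => by simpa using (mem_Q_iff.1 hp.1).2.2 t

end

/-! ### The slimmed tropical polytope of a gate system -/

namespace GateSystem

variable {S V : Type*} [Finite S] {μ : S → S → ℝ} {T : S → Set V} {σ : V → S}
  {E : V → V → Prop} {side : V → V → Set V} {p q : CRSpace S}

variable (H : GateSystem μ T σ E side)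
include H

theorem eq_pt (hp : p ∈ nonnegPart (Q μ)) {v : V} (h : p (Sum.inl (σ v)) = 0)
    (h' : p (Sum.inr (σ v)) = 0) : p = pt μ (σ v) := by
  funext x
  have := H.vertex_eq (mem_nonnegPart_Q_iff.1 hp) h h'
  rcases x with s | s
  exacts [(this s).1, (this s).2]

theorem not_isFat (hμ : ∃ s t, μ s t ≠ 0) (hp : p ∈ nonnegPart (Q μ))
    (ha : ∃ v, p (Sum.inl (σ v)) = 0) (hb : ∃ v, p (Sum.inr (σ v)) = 0)
    (hx : ∃ x, p (Sum.inl x) = 0 ∧ p (Sum.inr x) = 0) : ¬ IsFat μ p := by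
  rintro ⟨X, hX, hpX, hN⟩
  have hp' := mem_nonnegPart_Q_iff.1 hp
  obtain ⟨s₀, hs₀⟩ : ∃ s, s ∉ X := by
    by_contra! h
    obtain ⟨s, t, hst⟩ := hμ
    exact hst (hX s (h s) t (h t))
  rw [mem_QX_iff H.diag hp] at hpX
  obtain ⟨x, hx⟩ := hx
  obtain ⟨v, hv⟩ := ha
  obtain ⟨u, hu⟩ := hb
  have hxX : x ∈ X := by rw [hpX]; exact hx
  rw [N_inl, N_inr, Set.image_subset_image_iff Sum.inr_injective,
    Set.image_subset_image_iff Sum.inl_injective] at hN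
  rcases hN with hN | hN
  · by_cases hvX : σ v ∈ X
    · refine hN ⟨s₀, hs₀, ?_⟩ hvX
      rw [hpX] at hvX
      rw [hvX.2, add_zero]
      exact (H.vertex_eq hp' hvX.1 hvX.2 s₀).1
    · refine hN ⟨σ v, hvX, ?_⟩ hxX
      have := hp'.le_add (σ v) x
      linarith [H.nonneg (σ v) x, hx.2]
  · by_cases huX : σ u ∈ X
    · refine hN ⟨s₀, hs₀, ?_⟩ huX
      rw [hpX] at huX
      rw [huX.1, zero_add]
      exact (H.vertex_eq hp' huX.1 huX.2 s₀).2
    · refine hN ⟨σ u, huX, ?_⟩ hxX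
      have := hp'.le_add x (σ u)
      linarith [H.nonneg x (σ u), hx.1]

theorem mem_nonnegPart_Qslim_iff :
    p ∈ nonnegPart (Qslim μ) ↔ p ∈ nonnegPart (Q μ) ∧ (∃ v, p (Sum.inl (σ v)) = 0) ∧
      ∃ v, p (Sum.inr (σ v)) = 0 := by
  constructor
  · rintro ⟨⟨hQ, hf⟩, h0⟩
    have hp : p ∈ nonnegPart (Q μ) := ⟨hQ, h0⟩
    have hp' := mem_nonnegPart_Q_iff.1 hp
    refine ⟨hp, ?_, ?_⟩
    · by_contra! h
      obtain ⟨h₁, u, hu, h₂⟩ := H.fat_of_forall_pos hp' fun v => (h0 _).lt_of_ne' (h v)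
      exact hf (isProperFat_of_left ⟨H.nonneg, H.diag⟩ hp h₁ ⟨σ u, hu, hp'.exists_left _, h₂⟩)
    · by_contra! h
      obtain ⟨h₁, u, hu, h₂⟩ := H.flip.fat_of_forall_pos hp'.flip fun v => (h0 _).lt_of_ne' (h v)
      refine hf (isProperFat_of_right ⟨H.nonneg, H.diag⟩ hp (fun s x hx hx' he => ?_)
        ⟨σ u, hu, hp'.exists_right _, fun s hs => ?_⟩)
      · exact (h₁ s x hx' hx ((add_comm _ _).trans he)).symm
      · exact (h₂ s ((add_comm _ _).trans hs)).symm
  · rintro ⟨hp, ha, hb⟩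
    refine ⟨⟨hp.1, ?_⟩, hp.2⟩
    by_cases hμ : ∃ s t, μ s t ≠ 0
    · by_cases hx : ∃ x, p (Sum.inl x) = 0 ∧ p (Sum.inr x) = 0
      · exact fun hf => H.not_isFat hμ hp ha hb hx hf.1
      · exact not_isProperFat_of_forall_ne H.diag hp fun s hs => hx ⟨s, hs⟩
    · push Not at hμ
      refine not_isProperFat_of_forall_zero hμ hp.1 ?_
      have hp' := mem_nonnegPart_Q_iff.1 hp
      funext x
      rcases x with s | s
      · obtain ⟨t, ht⟩ := hp'.exists_right s
        exact le_antisymm (by rw [Pi.zero_apply]; linarith [hμ s t, hp'.nonneg_right t]) (hp.2 _)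
      · obtain ⟨t, ht⟩ := hp'.exists_left s
        exact le_antisymm (by rw [Pi.zero_apply]; linarith [hμ t s, hp'.nonneg_left t]) (hp.2 _)

theorem pt_mem (v : V) : pt μ (σ v) ∈ nonnegPart (Qslim μ) := by
  rw [H.mem_nonnegPart_Qslim_iff, mem_nonnegPart_Q_iff]
  refine ⟨⟨fun s => H.nonneg _ _, fun s => H.nonneg _ _, fun s t => H.triangle s t v,
    fun s => ⟨σ v, ?_⟩, fun s => ⟨σ v, ?_⟩⟩, ⟨v, H.diag _⟩, ⟨v, H.diag _⟩⟩
  · simp [pt, H.diag]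
  · simp [pt, H.diag]

theorem segment_mem {u v : V} (h : E u v) (h0 : μ (σ v) (σ u) = 0)
    (hp : p ∈ segment ℝ (pt μ (σ u)) (pt μ (σ v))) : p ∈ nonnegPart (Qslim μ) := by
  rw [segment_eq_image] at hp
  obtain ⟨c, ⟨hc₀, hc₁⟩, rfl⟩ := hp
  have hc₁' := sub_nonneg.2 hc₁
  rw [H.mem_nonnegPart_Qslim_iff, mem_nonnegPart_Q_iff]
  refine ⟨⟨fun s => ?_, fun s => ?_, fun s t => ?_, H.edge_tight h h0 c, fun t => ?_⟩,
    ⟨v, ?_⟩, ⟨u, ?_⟩⟩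
  · exact add_nonneg (mul_nonneg hc₁' (H.nonneg _ _)) (mul_nonneg hc₀ (H.nonneg _ _))
  · exact add_nonneg (mul_nonneg hc₁' (H.nonneg _ _)) (mul_nonneg hc₀ (H.nonneg _ _))
  · have h₁ := mul_le_mul_of_nonneg_left (H.triangle s t u) hc₁'
    have h₂ := mul_le_mul_of_nonneg_left (H.triangle s t v) hc₀
    simp only [pt, Pi.add_apply, Pi.smul_apply, Sum.elim_inl, Sum.elim_inr, smul_eq_mul]
    linarith
  · obtain ⟨s, hs⟩ := H.flip.edge_tight (H.symm h) h0 (1 - c) t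
    refine ⟨s, ?_⟩
    simp only [_root_.flip] at hs
    simp only [pt, Pi.add_apply, Pi.smul_apply, Sum.elim_inl, Sum.elim_inr, smul_eq_mul]
    linarith
  · simp [pt, h0, H.diag]
  · simp [pt, h0, H.diag]

/-- A point of `(Q_μ^{slim})^+` is a vertex `μ_v` or lies inside the segment of an edge. -/
theorem vertex_or_edge (hp : p ∈ nonnegPart (Qslim μ)) :
    (∃ v, p = pt μ (σ v)) ∨
    ∃ u v, E u v ∧ 0 < μ (σ u) (σ v) ∧ p ∈ segment ℝ (pt μ (σ u)) (pt μ (σ v)) ∧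
      ∀ s, p (Sum.inl s) = 0 → p (Sum.inr s) = 0 → u ∈ T s ∧ v ∈ T s := by
  obtain ⟨hp, ha, hb⟩ := H.mem_nonnegPart_Qslim_iff.1 hp
  have hp' := mem_nonnegPart_Q_iff.1 hp
  by_cases hv : ∃ v, p (Sum.inl (σ v)) = 0 ∧ p (Sum.inr (σ v)) = 0
  · obtain ⟨v, h, h'⟩ := hv
    exact Or.inl ⟨v, H.eq_pt hp h h'⟩
  right
  obtain ⟨u, v, h, h0, hav, hbu, hau, hbv, he⟩ := H.exists_edge hp' (fun v => by
    refine (add_nonneg (hp.2 _) (hp.2 _)).lt_of_ne' fun h => hv ⟨v, ?_⟩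
    exact (add_eq_zero_iff_of_nonneg (hp.2 _) (hp.2 _)).1 h) ha hb
  have hpos : 0 < μ (σ u) (σ v) := by linarith
  refine ⟨u, v, h, hpos, ?_, fun s hs hs' => H.mem_of_edge hp' h hau hbv he hs hs'⟩
  rw [segment_eq_image]
  have hc₀ : 0 ≤ p (Sum.inl (σ u)) / μ (σ u) (σ v) := by positivity
  have hc₁ : p (Sum.inl (σ u)) / μ (σ u) (σ v) ≤ 1 := (div_le_one hpos).2 (by linarith)
  refine ⟨_, ⟨hc₀, hc₁⟩, ?_⟩
  have key := H.edge_eq hp' h h0 hav hbu he hc₀ hc₁ (div_mul_cancel₀ _ hpos.ne')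
  funext x
  rcases x with s | s
  exacts [(key s).1.symm, (key s).2.symm]

theorem eq_of_slimRel (hp : p ∈ nonnegPart (Qslim μ)) (hq : q ∈ nonnegPart (Qslim μ))
    (h : SlimRel μ p q) : p = q := by
  obtain ⟨hp, ⟨v, hv⟩, -⟩ := H.mem_nonnegPart_Qslim_iff.1 hp
  obtain ⟨hq, ⟨v', hv'⟩, -⟩ := H.mem_nonnegPart_Qslim_iff.1 hq
  rcases h with ⟨c, h⟩ | ⟨X, -, hpX, hqX, c, d, h⟩
  · have h₁ := congrFun h (Sum.inl (σ v))
    have h₂ := congrFun h (Sum.inl (σ v'))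
    simp only [shiftVec, Pi.sub_apply, Pi.smul_apply, Sum.elim_inl, Set.indicator_univ,
      smul_eq_mul, mul_one] at h₁ h₂
    have hc : c = 0 := by linarith [hq.2 (Sum.inl (σ v)), hp.2 (Sum.inl (σ v'))]
    rw [hc, zero_smul] at h
    exact sub_eq_zero.1 h
  · have hX := (mem_QX_iff H.diag hp).1 hpX.1
    have hX' := (mem_QX_iff H.diag hq).1 hqX.1
    by_cases hw : ∃ w, σ w ∈ X
    · obtain ⟨w, hw⟩ := hw
      have hw' := hw
      rw [hX] at hw
      rw [hX'] at hw'
      rw [H.eq_pt hp hw.1 hw.2, H.eq_pt hq hw'.1 hw'.2]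
    · push Not at hw
      have h₁ := congrFun h (Sum.inl (σ v))
      have h₂ := congrFun h (Sum.inl (σ v'))
      simp only [shiftVec, Pi.sub_apply, Pi.add_apply, Pi.smul_apply, Sum.elim_inl,
        Set.indicator_univ, Set.indicator_of_notMem (hw _), smul_eq_mul, mul_one, mul_zero,
        add_zero] at h₁ h₂
      have hc : c = 0 := by linarith [hq.2 (Sum.inl (σ v)), hp.2 (Sum.inl (σ v'))]
      funext x
      by_cases hd : d = 0
      · rw [hc, hd, zero_smul, zero_smul, add_zero] at h
        exact congrFun (sub_eq_zero.1 h) x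
      · have hX0 : X = ∅ := by
          refine Set.eq_empty_of_forall_notMem fun s hs => hd ?_
          have h₃ := congrFun h (Sum.inl s)
          have hs' := hs
          have hs'' := hs
          rw [hX] at hs'
          rw [hX'] at hs''
          simpa [shiftVec, hc, hs, hs'.1, hs''.1] using h₃.symm
        have := congrFun h x
        rw [hX0] at this
        rcases x with s | s <;> simpa [shiftVec, hc, sub_eq_zero] using this

theorem exists_slimRel [Nonempty S] (hp : p ∈ Qslim μ) :
    ∃ q ∈ nonnegPart (Qslim μ), SlimRel μ q p := by
  obtain ⟨s, hs⟩ := Finite.exists_min fun s => p (Sum.inl s)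
  set q : CRSpace S := p + (-p (Sum.inl s)) • shiftVec Set.univ with hq
  have hsub : q - p = (-p (Sum.inl s)) • shiftVec Set.univ := by rw [hq, add_sub_cancel_left]
  have hqQ : q ∈ Q μ := shift_mem_Q hp.1 _
  refine ⟨q, ⟨⟨hqQ, fun hf => hp.2 (isProperFat_of_K_eq hqQ hp.1 (K_eq_of_sub hsub) hf)⟩, ?_⟩,
    Or.inl ⟨_, hsub⟩⟩
  rintro (t | t)
  · have := hs t
    simpa [hq, shiftVec] using this
  · have h₁ := hp.1.1 s t
    have h₂ := H.nonneg s t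
    simp only [hq, shiftVec, Pi.add_apply, Pi.smul_apply, Sum.elim_inr, Set.indicator_univ,
      smul_eq_mul]
    linarith

theorem isSlimmedSection [Nonempty S] : IsSlimmedSection μ (nonnegPart (Qslim μ)) := by
  refine ⟨subset_rfl, ⟨fun p hp => hp.1, fun _ _ => trivial, ?_, ?_⟩, ?_, ?_⟩
  · rintro p hp q hq h
    exact Subtype.ext (H.eq_of_slimRel hp hq (Quotient.exact h))
  · rintro x -
    obtain ⟨p, rfl⟩ := Quotient.exists_rep x
    obtain ⟨q, hq, h⟩ := H.exists_slimRel p.2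
    exact ⟨⟨q, hq.1⟩, hq, Quotient.sound h⟩
  · rintro ⟨p, hp, q, hq, h⟩
    obtain ⟨-, ⟨v, hv⟩, ⟨u, hu⟩⟩ := H.mem_nonnegPart_Qslim_iff.1 hq
    rcases h with h | h
    · linarith [h (σ v), hp.2 (Sum.inl (σ v))]
    · linarith [h (σ u), hp.2 (Sum.inr (σ u))]
  · rintro X - ⟨p, ⟨hp, hpX, -⟩, q, ⟨hq, hqX, -⟩, hne, h⟩
    obtain ⟨hp, -⟩ := H.mem_nonnegPart_Qslim_iff.1 hp
    obtain ⟨hq, ⟨v, hv⟩, ⟨u, hu⟩⟩ := H.mem_nonnegPart_Qslim_iff.1 hq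
    have hX := (mem_QX_iff H.diag hp).1 hpX.1
    have hX' := (mem_QX_iff H.diag hq).1 hqX.1
    have hw : ∀ w, σ w ∉ X := fun w hw => by
      have hw' := hw
      rw [hX] at hw
      rw [hX'] at hw'
      exact hne (by rw [H.eq_pt hp hw.1 hw.2, H.eq_pt hq hw'.1 hw'.2])
    rcases h with h | h
    · linarith [h (σ v) (hw v), hp.2 (Sum.inl (σ v))]
    · linarith [h (σ u) (hw u), hp.2 (Sum.inr (σ u))]

/-- If `T s` has a last node `v` and a first node `u`, then the region of `s` contains no fat. -/
theorem not_isFat_of_mem_region (hμ : ∃ s t, μ s t ≠ 0) {s : S} {u v : V}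
    (hv : ∀ t, μ (σ v) t ≤ μ s t) (hu : ∀ t, μ t (σ u) ≤ μ t s)
    (hp : p ∈ region (Q μ) s) : ¬ IsFat μ p := by
  obtain ⟨hpQ, hs⟩ := hp
  intro hf
  set q : CRSpace S := p + (-p (Sum.inl s)) • shiftVec Set.univ with hq
  have hsub : q - p = (-p (Sum.inl s)) • shiftVec Set.univ := by rw [hq, add_sub_cancel_left]
  have hqQ : q ∈ Q μ := shift_mem_Q hpQ _
  have hql : q (Sum.inl s) = 0 := by simp [hq, shiftVec]
  have hqr : q (Sum.inr s) = 0 := by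
    have : q (Sum.inl s) + q (Sum.inr s) = p (Sum.inl s) + p (Sum.inr s) := shift_add _ s s
    linarith
  have hq0 : q ∈ nonnegPart (Q μ) := by
    refine ⟨hqQ, ?_⟩
    rintro (t | t)
    · linarith [hqQ.1 t s, H.nonneg t s]
    · linarith [hqQ.1 s t, H.nonneg s t]
  refine H.not_isFat hμ hq0 ⟨v, ?_⟩ ⟨u, ?_⟩ ⟨s, hql, hqr⟩
    (isFat_of_K_eq hqQ (K_eq_of_sub hsub).symm hf)
  · obtain ⟨t, ht⟩ := (mem_Q_iff.1 hqQ).2.1 (σ v)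
    exact le_antisymm (by linarith [hv t, hqQ.1 s t]) (hq0.2 _)
  · obtain ⟨t, ht⟩ := (mem_Q_iff.1 hqQ).2.2 (σ u)
    exact le_antisymm (by linarith [hu t, hqQ.1 t s]) (hq0.2 _)

end GateSystem

/-! ### Oriented-tree realizations -/

namespace IsRealization

open OrientedTree

variable {S V : Type*} {μ : S → S → ℝ} {Γ : OrientedTree V} {α : V → V → ℝ}
  {F : S → Γ.graph.Subgraph}

variable (hF : IsRealization μ Γ α F)
include hF

theorem le_dist {s t : S} {u v : V} (hu : u ∈ (F s).verts) (hv : v ∈ (F t).verts) :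
    μ s t ≤ Γ.dist α u v := by
  rw [hF.dist_eq]
  refine csInf_le ⟨0, ?_⟩ ⟨u, hu, v, hv, rfl⟩
  rintro _ ⟨x, -, y, -, rfl⟩
  exact Γ.dist_nonneg hF.length_nonneg x y

theorem exists_dist_eq [Finite V] (s t : S) :
    ∃ u ∈ (F s).verts, ∃ v ∈ (F t).verts, μ s t = Γ.dist α u v := by
  obtain ⟨u, hu⟩ := nonempty_verts (hF.subtree s)
  obtain ⟨v, hv⟩ := nonempty_verts (hF.subtree t)
  have hfin : {x | ∃ u ∈ (F s).verts, ∃ v ∈ (F t).verts, x = Γ.dist α u v}.Finite := by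
    refine (Set.finite_range fun z : V × V => Γ.dist α z.1 z.2).subset ?_
    rintro _ ⟨x, -, y, -, rfl⟩
    exact ⟨(x, y), rfl⟩
  have hne : {x | ∃ u ∈ (F s).verts, ∃ v ∈ (F t).verts, x = Γ.dist α u v}.Nonempty :=
    ⟨_, u, hu, v, hv, rfl⟩
  rw [hF.dist_eq]
  exact hne.csInf_mem hfin

theorem pt_congr {s t : S} (h : (F s).verts = (F t).verts) : pt μ s = pt μ t := by
  funext x
  rcases x with x | x <;> simp only [pt, Sum.elim_inl, Sum.elim_inr, hF.dist_eq, h]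

variable {σ : V → S} (hσ : ∀ v, IsNode (F (σ v)) v)
include hσ

theorem le_dist_to {s : S} {x v : V} (hx : x ∈ (F s).verts) : μ s (σ v) ≤ Γ.dist α x v :=
  hF.le_dist hx (by rw [hσ]; rfl)

theorem le_dist_of {s : S} {x v : V} (hx : x ∈ (F s).verts) : μ (σ v) s ≤ Γ.dist α v x :=
  hF.le_dist (by rw [hσ]; rfl) hx

variable [Finite V]

theorem dist_node (u v : V) : μ (σ u) (σ v) = Γ.dist α u v := by
  obtain ⟨x, hx, y, hy, h⟩ := hF.exists_dist_eq (σ u) (σ v)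
  rw [hσ] at hx hy
  rw [h, Set.mem_singleton_iff.1 hx, Set.mem_singleton_iff.1 hy]

theorem exists_dist_to (s : S) (v : V) : ∃ x ∈ (F s).verts, μ s (σ v) = Γ.dist α x v := by
  obtain ⟨x, hx, y, hy, h⟩ := hF.exists_dist_eq s (σ v)
  rw [hσ] at hy
  exact ⟨x, hx, by rw [h, Set.mem_singleton_iff.1 hy]⟩

theorem exists_dist_of (s : S) (v : V) : ∃ x ∈ (F s).verts, μ (σ v) s = Γ.dist α v x := by
  obtain ⟨y, hy, x, hx, h⟩ := hF.exists_dist_eq (σ v) s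
  rw [hσ] at hy
  exact ⟨x, hx, by rw [h, Set.mem_singleton_iff.1 hy]⟩

theorem gateSystem (hμ : IsDirectedDistance μ) :
    GateSystem μ (fun s => (F s).verts) σ Γ.graph.Adj Γ.side where
  nonneg := hμ.nonneg
  diag := hμ.diag
  single := hσ
  symm h := h.symm
  mem_side := mem_side_self
  side_compl := side_compl
  side_subset := side_subset_side
  direction {s v} hv := by
    obtain ⟨z, hz⟩ := nonempty_verts (hF.subtree s)
    obtain ⟨w, h, hw, -⟩ := exists_subset_side (hF.subtree s) hv hz
    exact ⟨w, h, hw⟩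
  subset_or s h := subset_side_or (hF.subtree s) h
  gate h := exists_gate (hF.subtree _) (hF.subtree _) h
  exists_mutual n hn := by
    have : Nonempty V := Γ.isTree.1.nonempty
    exact exists_mutual n hn
  triangle s t v := by
    obtain ⟨x, hx, h⟩ := hF.exists_dist_to hσ s v
    obtain ⟨y, hy, h'⟩ := hF.exists_dist_of hσ t v
    rw [h, h']
    exact (hF.le_dist hx hy).trans (Γ.dist_triangle hF.length_nonneg _ _ _)
  to_mem hv := le_antisymm ((hF.le_dist_to hσ hv).trans_eq (Γ.dist_self _)) (hμ.nonneg _ _)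
  of_mem hv := le_antisymm ((hF.le_dist_of hσ hv).trans_eq (Γ.dist_self _)) (hμ.nonneg _ _)
  cross {s t v w} h hs ht := by
    rw [hF.dist_node hσ]
    refine le_antisymm ?_ ?_
    · obtain ⟨x, hx, hx'⟩ := hF.exists_dist_to hσ s w
      obtain ⟨y, hy, hy'⟩ := hF.exists_dist_of hσ t v
      rw [hx', hy', ← dist_cross h (hs hx) (ht hy)]
      exact hF.le_dist hx hy
    · obtain ⟨x, hx, y, hy, hxy⟩ := hF.exists_dist_eq s t
      rw [hxy, dist_cross h (hs hx) (ht hy)]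
      exact add_le_add (add_le_add (hF.le_dist_to hσ hx) le_rfl) (hF.le_dist_of hσ hy)
  one_way {v w} h := by
    rw [hF.dist_node hσ, hF.dist_node hσ]
    exact ((Γ.graph_adj.1 h).imp Γ.dist_eq_zero_of_adj Γ.dist_eq_zero_of_adj).symm

/-- A node or a directed path has a first and a last node. -/
theorem exists_ends {s : S} (h : (∃ v, IsNode (F s) v) ∨ IsDirectedPath (F s)) :
    ∃ u v, (∀ t, μ (σ v) t ≤ μ s t) ∧ ∀ t, μ t (σ u) ≤ μ t s := by
  obtain ⟨u, v, hx⟩ : ∃ u v, ∀ x ∈ (F s).verts, Γ.dist α v x = 0 ∧ Γ.dist α x u = 0 := by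
    rcases h with ⟨v, hv⟩ | ⟨u, v, w, -, hw, hs⟩
    · refine ⟨v, v, fun x hx => ?_⟩
      rw [hv, Set.mem_singleton_iff] at hx
      rw [hx]
      exact ⟨Γ.dist_self v, Γ.dist_self v⟩
    · refine ⟨u, v, fun x hx => ?_⟩
      rw [hs, SimpleGraph.Walk.mem_verts_toSubgraph] at hx
      exact Γ.dist_eq_zero_of_mem_directed hF.length_nonneg w hw hx
  refine ⟨u, v, fun t => ?_, fun t => ?_⟩
  · obtain ⟨x, hxs, y, hy, h⟩ := hF.exists_dist_eq s t
    rw [h]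
    refine (hF.le_dist_of hσ hy).trans ((Γ.dist_triangle hF.length_nonneg _ _ x).trans_eq ?_)
    rw [(hx x hxs).1, zero_add]
  · obtain ⟨y, hy, x, hxs, h⟩ := hF.exists_dist_eq t s
    rw [h]
    refine (hF.le_dist_to hσ hy).trans ((Γ.dist_triangle hF.length_nonneg _ _ x).trans_eq ?_)
    rw [(hx x hxs).2, add_zero]

theorem segmentUnion_subset (hμ : IsDirectedDistance μ) [Finite S] (H : Γ.graph.Subgraph) :
    segmentUnion μ Γ F H ⊆ nonnegPart (Qslim μ) := by
  have G := hF.gateSystem hσ hμ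
  rintro p (⟨s, v, hs, -, rfl⟩ | ⟨s, t, u, v, hs, ht, huv, -, hp⟩)
  · rw [hF.pt_congr (hs.trans (hσ v).symm)]
    exact G.pt_mem v
  · rw [hF.pt_congr (hs.trans (hσ u).symm), hF.pt_congr (ht.trans (hσ v).symm)] at hp
    refine G.segment_mem (Γ.graph_adj.2 (Or.inl huv)) ?_ hp
    rw [hF.dist_node hσ, Γ.dist_eq_zero_of_adj huv]

theorem nonnegPart_Qslim_eq (hμ : IsDirectedDistance μ) [Finite S] :
    nonnegPart (Qslim μ) = segmentUnion μ Γ F ⊤ := by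
  refine Set.Subset.antisymm (fun p hp => ?_) (hF.segmentUnion_subset hσ hμ ⊤)
  rcases (hF.gateSystem hσ hμ).vertex_or_edge hp with ⟨v, hv⟩ | ⟨u, v, h, hpos, hseg, -⟩
  · exact Or.inl ⟨σ v, v, hσ v, trivial, hv⟩
  · rw [hF.dist_node hσ] at hpos
    exact Or.inr ⟨σ u, σ v, u, v, hσ u, hσ v, Γ.adj_of_dist_pos h hpos, h, hseg⟩

theorem region_nonnegPart_Qslim_eq (hμ : IsDirectedDistance μ) [Finite S] (s : S) :
    region (nonnegPart (Qslim μ)) s = segmentUnion μ Γ F (F s) := by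
  have G := hF.gateSystem hσ hμ
  refine Set.Subset.antisymm ?_ fun p hp => ⟨hF.segmentUnion_subset hσ hμ _ hp, ?_⟩
  · rintro p ⟨hp, hs⟩
    obtain ⟨h₁, h₂⟩ := (add_eq_zero_iff_of_nonneg (hp.2 _) (hp.2 _)).1 hs
    rcases G.vertex_or_edge hp with ⟨v, rfl⟩ | ⟨u, v, h, hpos, hseg, hmem⟩
    · obtain ⟨w, hw, h₃, h₄⟩ := G.exists_mem_of_zero h₁ h₂
      refine Or.inl ⟨σ w, w, hσ w, hw, ?_⟩
      have key := G.dist_eq_of_zero h₃ h₄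
      funext x
      rcases x with t | t
      exacts [(key t).2, (key t).1]
    · rw [hF.dist_node hσ] at hpos
      obtain ⟨hu, hv⟩ := hmem s h₁ h₂
      exact Or.inr ⟨σ u, σ v, u, v, hσ u, hσ v, Γ.adj_of_dist_pos h hpos,
        adj_of_mem_of_mem (hF.subtree s) h hu hv, hseg⟩
  · rcases hp with ⟨t, v, ht, hv, rfl⟩ | ⟨t, t', u, v, ht, ht', -, huv, hp⟩
    · rw [hF.pt_congr (ht.trans (hσ v).symm)]
      simp [pt, G.to_mem hv, G.of_mem hv]
    · rw [hF.pt_congr (ht.trans (hσ u).symm), hF.pt_congr (ht'.trans (hσ v).symm)] at hp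
      obtain ⟨c, d, -, -, -, rfl⟩ := hp
      simp [pt, G.to_mem huv.fst_mem, G.of_mem huv.fst_mem, G.to_mem huv.snd_mem,
        G.of_mem huv.snd_mem]

end IsRealization

end DirectedMultiflow

end

open DirectedMultiflow in
theorem mainTheorem7 {S V : Type*} [Finite S] (μ : S → S → ℝ) (hμ : IsDirectedDistance μ)
    (Γ : OrientedTree V) (α : V → V → ℝ) (F : S → Γ.graph.Subgraph)
    (hF : IsRealization μ Γ α F) (hall : ∀ v : V, ∃ s, IsNode (F s) v) :
    nonnegPart (Qslim μ) = segmentUnion μ Γ F ⊤ ∧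
    (∀ s, region (nonnegPart (Qslim μ)) s = segmentUnion μ Γ F (F s)) ∧
    IsSlimmedSection μ (nonnegPart (Qslim μ)) ∧
    ((∃ s t, μ s t ≠ 0) → ∀ s, ((∃ v, IsNode (F s) v) ∨ IsDirectedPath (F s)) →
      ∀ p ∈ region (Q μ) s, ¬ IsFat μ p) := by
  choose σ hσ using hall
  have : Finite V := Finite.of_injective σ fun u v h =>
    Set.singleton_injective ((hσ u).symm.trans ((congrArg (fun s => (F s).verts) h).trans (hσ v)))
  obtain ⟨v₀⟩ : Nonempty V := Γ.isTree.1.nonempty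
  have : Nonempty S := ⟨σ v₀⟩
  have G := hF.gateSystem hσ hμ
  refine ⟨hF.nonnegPart_Qslim_eq hσ hμ, hF.region_nonnegPart_Qslim_eq hσ hμ,
    G.isSlimmedSection, fun h0 s hs p hp => ?_⟩
  obtain ⟨u, v, hv, hu⟩ := hF.exists_ends hσ hs
  exact G.not_isFat_of_mem_region h0 hv hu hp
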